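/- Let $n\in\{2,3\}$, let $\mathbb{T}^n=(\mathbb{R}/2\pi\mathbb{Z})^n$, and let $\sigma>0$. Write $\hat f(k)$ for the Fourier coefficients of $f=\sum_{k\in\mathbb{Z}^n}\hat f(k)e^{ik\cdot x}$, let $(-\Delta)^{s}$ have symbol $|k|^{2s}$, and set $\|f\|_{\dot H^s}=\|(-\Delta)^{s/2}f\|_{L^2(\mathbb{T}^n)}$. Let $\mathring L^2(\mathbb{T}^n;\mathbb{R}^d)$ be the space of mean-zero fields in $L^2(\mathbb{T}^n;\mathbb{R}^d)$, and $L^2_\sigma$ the space of divergence-free fields in $\mathring L^2(\mathbb{T}^n;\mathbb{R}^n)$. For a bounded operator $G$ from a real Hilbert space into $\mathring L^2(\mathbb{T}^n;\mathbb{R}^d)$, a $GG^*$-Wiener process is a process $B$ with $B(0)=0$, with continuous trajectories in $L^2$ and independent increments, and such that $B(t)-B(s)$ has law $N(0,(t-s)GG^*)$ for $s\le t$. Consider, on a probability space $(\Omega,\mathcal{F},\mathbf{P})$, one of the equations $$dz+(-\Delta)^{\lambda}z\,dt+\nabla\pi\,dt=dB,\quad \nabla\cdot z=0,\quad z(0)=0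 \qquad (d=n),$$ or $$dz+(-\Delta)^{\lambda}z\,dt=dB,\quad z(0)=0\qquad (d\text{ arbitrary}),$$ where $B$ is a $GG^*$-Wiener process and $\lambda\in(0,\tfrac12+\tfrac n4)$. A solution is a process $z$ with values in $V=L^2_\sigma$, respectively $V=\mathring L^2(\mathbb{T}^n;\mathbb{R}^d)$, such that $z(0)=0$ almost surely and, for every smooth $\varphi\in V$, almost surely for all $t\ge 0$ the function $r\mapsto\langle z(r),(-\Delta)^\lambda\varphi\rangle$ is integrable on $[0,t]$ and $$\langle z(t),\varphi\rangle+\int_0^t\langle z(r),(-\Delta)^\lambda\varphi\rangle\,dr=\langle B(t),\varphi\rangle .$$ Suppose that $$\operatorname{Tr}\big((-\Delta)^{\max\{\frac n2+2\sigma,\ \frac{n+2}{2}-\lambda+2\sigma\}}GG^*\big)<\infty .$$ Then every solution $z$ satisfies, for all $\delta\in(0,\tfrac12)$, $T>0$ and $l\in\mathbb{N}$: almost surely $z\in C([0,T];\dot H^{\frac{2+n+\sigma}{2}})$, the two norms below are random variables, and $$\mathbb{E}^{\mathbf P}\Big[\|z\|^l_{C([0,T];\dot H^{\frac{2+n+\sigma}{2}})}+\|z\|^l_{C^{\frac12-\delta}([0,T];\dot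 H^{\frac{n+\sigma}{2}})}\Big]<\infty. \tag{$*$}$$ Consequently, let $m\in(0,1)$ if $n=2$ and $m\in(\tfrac{13}{20},\tfrac54)$ if $n=3$, let $G_1,G_2$ be bounded operators from real Hilbert spaces into $L^2_\sigma$ and $\mathring L^2(\mathbb{T}^n;\mathbb{R})$, respectively, with $$\operatorname{Tr}\big((-\Delta)^{\max\{\frac n2+2\sigma,\ \frac{n+2}{2}-m+2\sigma\}}G_1G_1^*\big)<\infty,\qquad \operatorname{Tr}\big((-\Delta)^{\frac n2+2\sigma}G_2G_2^*\big)<\infty,$$ and let $B_1,B_2$ be $G_1G_1^*$- and $G_2G_2^*$-Wiener processes. Then the solutions $z_1$ of $dz_1+(-\Delta)^m z_1\,dt+\nabla\pi_1\,dt=dB_1$, $\nabla\cdot z_1=0$, $z_1(0)=0$, and $z_2$ of $dz_2-\Delta z_2\,dt=dB_2$, $z_2(0)=0$, both satisfy $(*)$. -/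

import Mathlib

open MeasureTheory ProbabilityTheory Filter
open scoped NNReal ENNReal Topology

noncomputable section

/-! ### Vector fields on the torus `(ℝ / 2πℤ)ⁿ` -/

instance factTwoPiPos : Fact ((0 : ℝ) < 2 * Real.pi) := ⟨Real.two_pi_pos⟩

/-- The torus `𝕋ⁿ = (ℝ / 2πℤ)ⁿ`; its `volume` is Lebesgue measure, of total mass `(2π)ⁿ`. -/
abbrev Torus (n : ℕ) : Type := Fin n → AddCircle (2 * Real.pi)

/-- The real Hilbert space `L²(𝕋ⁿ; ℝᵈ)`. -/
abbrev L2Field (n d : ℕ) : Type := Lp (EuclideanSpace ℝ (Fin d)) 2 (volume : Measure (Torus n))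

instance L2Field.instMeasurableSpace (n d : ℕ) : MeasurableSpace (L2Field n d) := borel _

instance L2Field.instBorelSpace (n d : ℕ) : BorelSpace (L2Field n d) := ⟨rfl⟩

/-- The character `x ↦ exp (i k · x)` of the torus, `k ∈ ℤⁿ`. -/
def character {n : ℕ} (k : Fin n → ℤ) : C(Torus n, ℂ) where
  toFun x := ∏ i, fourier (k i) (x i)
  continuous_toFun := by fun_prop

/-- The `k`-th Fourier coefficient `(2π)⁻ⁿ ∫ f_c(x) exp (-i k · x) dx` of the `c`-th component
of `f`, so that `f_c = ∑ k, f̂_c(k) exp (i k · x)`. -/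
def fieldCoeff {n d : ℕ} (f : L2Field n d) (k : Fin n → ℤ) (c : Fin d) : ℂ :=
  ((2 * Real.pi : ℂ) ^ n)⁻¹ * ∫ x : Torus n, character (-k) x * ((f x c : ℝ) : ℂ)

/-- The field `x ↦ cos (k · x) e_c`. -/
def cosField {n d : ℕ} (k : Fin n → ℤ) (c : Fin d) : L2Field n d :=
  ContinuousMap.toLp 2 (volume : Measure (Torus n)) ℝ
    ⟨fun x => (character k x).re • EuclideanSpace.single c (1 : ℝ), by fun_prop⟩

/-- The field `x ↦ sin (k · x) e_c`. -/
def sinField {n d : ℕ} (k : Fin n → ℤ) (c : Fin d) : L2Field n d :=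
  ContinuousMap.toLp 2 (volume : Measure (Torus n)) ℝ
    ⟨fun x => (character k x).im • EuclideanSpace.single c (1 : ℝ), by fun_prop⟩

/-- `f` has mean zero; the fields with this property form `L̊²`. -/
def IsMeanZero {n d : ℕ} (f : L2Field n d) : Prop := ∀ c, fieldCoeff f 0 c = 0

/-- `f` has mean zero and `∇ · f = 0` in the sense of distributions, i.e. all Fourier coefficients
`i k · f̂(k)` of the divergence vanish; the fields with this property form `L²_σ`. -/
def IsSolenoidal {n : ℕ} (f : L2Field n n) : Prop :=
  IsMeanZero f ∧ ∀ k, ∑ c, (k c : ℂ) * fieldCoeff f k c = 0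

/-! ### Powers of the Laplacian and homogeneous Sobolev norms -/

/-- The symbol `|k|^{2 s}` of `(-Δ)^s`, where `|k|` is the Euclidean length of `k ∈ ℤⁿ`. -/
def fracSymbol {n : ℕ} (s : ℝ) (k : Fin n → ℤ) : ℝ := (∑ i, (k i : ℝ) ^ 2) ^ s

/-- `ψ = (-Δ)^s φ`. -/
def IsFracLaplacian {n d : ℕ} (s : ℝ) (φ ψ : L2Field n d) : Prop :=
  ∀ k c, fieldCoeff ψ k c = (fracSymbol s k : ℂ) * fieldCoeff φ k c

/-- `‖f‖_{Ḣ^s} = ‖(-Δ)^{s/2} f‖_{L²} = ((2π)ⁿ ∑ k, |k|^{2 s} |f̂(k)|²)^{1/2} ∈ [0, ∞]` for a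
field `f` of mean zero. -/
def hdotNorm {n d : ℕ} (s : ℝ) (f : L2Field n d) : ℝ≥0∞ :=
  (ENNReal.ofReal ((2 * Real.pi) ^ n) *
    ∑' k : Fin n → ℤ, ENNReal.ofReal (fracSymbol s k) * ∑ c, ‖fieldCoeff f k c‖ₑ ^ 2) ^ (1 / 2 : ℝ)

/-- `f`, of mean zero, is smooth: it lies in `Ḣ^s` for every `s`. -/
def IsSmoothField {n d : ℕ} (f : L2Field n d) : Prop := ∀ s : ℝ, hdotNorm s f < ∞

/-- `Tr ((-Δ)^s Q) = ∑ ⟨Q e, (-Δ)^s e⟩ ∈ [0, ∞]`, for a positive operator `Q` and `s > 0`, computed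
in the eigenfunctions of the Laplacian: the sum of `|k|^{2 s} ⟨Q e, e⟩` over
`e = (2π)^{-n/2} exp (i k · x) e_c`, where
`⟨Q e, e⟩ = (2π)⁻ⁿ (⟨Q cos (k · x) e_c, cos (k · x) e_c⟩ + ⟨Q sin (k · x) e_c, sin (k · x) e_c⟩)`
by complexification. -/
def traceFracLaplacian {n d : ℕ} (s : ℝ) (Q : L2Field n d →L[ℝ] L2Field n d) : ℝ≥0∞ :=
  ∑' k : Fin n → ℤ, ∑ c : Fin d, ENNReal.ofReal (fracSymbol s k *
    (((2 * Real.pi) ^ n)⁻¹ * (inner ℝ (Q (cosField k c)) (cosField k c) +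
      inner ℝ (Q (sinField k c)) (sinField k c))))

/-! ### Wiener processes and linear stochastic equations -/

/-- The operator `G G*`. -/
def covOp {U : Type*} [NormedAddCommGroup U] [InnerProductSpace ℝ U] [CompleteSpace U] {n d : ℕ}
    (G : U →L[ℝ] L2Field n d) : L2Field n d →L[ℝ] L2Field n d :=
  G.comp (ContinuousLinearMap.adjoint G)

/-- `B` is a `Q`-Wiener process in `L²(𝕋ⁿ; ℝᵈ)`: it starts at `0`, has continuous trajectories and
independent increments, and `B t - B s` has law `N(0, (t - s) Q)` for `s ≤ t`. -/
structure IsWienerProcess {Ω : Type*} [MeasurableSpace Ω] (P : Measure Ω) {n d : ℕ}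
    (Q : L2Field n d →L[ℝ] L2Field n d) (B : ℝ≥0 → Ω → L2Field n d) : Prop where
  measurable : ∀ t, AEMeasurable (B t) P
  zero : ∀ᵐ ω ∂P, B 0 ω = 0
  continuous : ∀ᵐ ω ∂P, Continuous fun t => B t ω
  indep : HasIndepIncrements B P
  gaussian : ∀ s t : ℝ≥0, s ≤ t → ∀ φ : L2Field n d,
    P.map (fun ω => inner ℝ (B t ω - B s ω) φ) =
      gaussianReal 0 ((t - s) * (inner ℝ (Q φ) φ).toNNReal)

/-- `z` is a weak solution, in the space of the fields satisfying `V`, of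
`dz + (-Δ)^lam z dt = dB`, `z(0) = 0`: it takes values in that space, and for every smooth field
`φ` in that space `⟨z(t), φ⟩ - ⟨z(0), φ⟩ + ∫₀ᵗ ⟨z(r), (-Δ)^lam φ⟩ dr = ⟨B(t), φ⟩` for all `t ≥ 0`,
almost surely. -/
structure IsWeakSolution {Ω : Type*} [MeasurableSpace Ω] (P : Measure Ω) {n d : ℕ}
    (V : L2Field n d → Prop) (lam : ℝ) (B z : ℝ≥0 → Ω → L2Field n d) : Prop where
  mem : ∀ᵐ ω ∂P, ∀ t, V (z t ω)
  init : ∀ᵐ ω ∂P, z 0 ω = 0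
  weak : ∀ φ ψ : L2Field n d, V φ → IsSmoothField φ → IsFracLaplacian lam φ ψ →
    ∀ᵐ ω ∂P, ∀ t : ℝ≥0,
      IntervalIntegrable (fun r : ℝ => inner ℝ (z r.toNNReal ω) ψ) volume 0 t ∧
      inner ℝ (z t ω) φ - inner ℝ (z 0 ω) φ + ∫ r in (0 : ℝ)..t, inner ℝ (z r.toNNReal ω) ψ =
        inner ℝ (B t ω) φ

/-- `z` solves `dz + (-Δ)^lam z dt = dB`, `z(0) = 0`, among the fields of mean zero. -/
def IsHeatSolution {Ω : Type*} [MeasurableSpace Ω] (P : Measure Ω) {n d : ℕ} (lam : ℝ)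
    (B z : ℝ≥0 → Ω → L2Field n d) : Prop :=
  IsWeakSolution P IsMeanZero lam B z

/-- `z` solves `dz + (-Δ)^lam z dt + ∇π dt = dB`, `∇ · z = 0`, `z(0) = 0`, among the fields of mean
zero; solenoidal test fields eliminate the pressure `π`. -/
def IsStokesSolution {Ω : Type*} [MeasurableSpace Ω] (P : Measure Ω) {n : ℕ} (lam : ℝ)
    (B z : ℝ≥0 → Ω → L2Field n n) : Prop :=
  IsWeakSolution P IsSolenoidal lam B z

/-! ### Norms of trajectories on `[0, T]` -/

/-- The trajectory `f` lies in `C([0, T]; Ḣ^s)`. -/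
def IsContinuousHdot {n d : ℕ} (T : ℝ≥0) (s : ℝ) (f : ℝ≥0 → L2Field n d) : Prop :=
  ∀ t ≤ T, hdotNorm s (f t) < ∞ ∧
    Tendsto (fun r => hdotNorm s (f r - f t)) (𝓝[Set.Iic T] t) (𝓝 0)

/-- The norm of `C([0, T]; Ḣ^s)`. -/
def supHdotNorm {n d : ℕ} (T : ℝ≥0) (s : ℝ) (f : ℝ≥0 → L2Field n d) : ℝ≥0∞ :=
  ⨆ t ∈ Set.Iic T, hdotNorm s (f t)

/-- The norm of the Hölder space `C^γ([0, T]; Ḣ^s)`. -/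
def holderHdotNorm {n d : ℕ} (T : ℝ≥0) (γ s : ℝ) (f : ℝ≥0 → L2Field n d) : ℝ≥0∞ :=
  supHdotNorm T s f +
    ⨆ r ∈ Set.Iic T, ⨆ t ∈ Set.Iic T, ⨆ _ : r ≠ t, hdotNorm s (f t - f r) / edist t r ^ γ

/-- For all `δ ∈ (0, 1/2)`, `T > 0` and `l ∈ ℕ`, almost every trajectory of `z` lies in
`C([0, T]; Ḣ^{(2+n+σ)/2})`, and
`E [‖z‖^l_{C_T Ḣ^{(2+n+σ)/2}} + ‖z‖^l_{C_T^{1/2-δ} Ḣ^{(n+σ)/2}}] < ∞`,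
both norms being random variables. -/
def HasRegularityMoments {Ω : Type*} [MeasurableSpace Ω] (P : Measure Ω) {n d : ℕ} (σ : ℝ)
    (z : ℝ≥0 → Ω → L2Field n d) : Prop :=
  ∀ δ : ℝ, 0 < δ → δ < 1 / 2 → ∀ T : ℝ≥0, 0 < T → ∀ l : ℕ,
    (∀ᵐ ω ∂P, IsContinuousHdot T ((2 + n + σ) / 2) fun t => z t ω) ∧
    AEMeasurable (fun ω => supHdotNorm T ((2 + n + σ) / 2) fun t => z t ω) P ∧
    AEMeasurable (fun ω => holderHdotNorm T (1 / 2 - δ) ((n + σ) / 2) fun t => z t ω) P ∧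
    ∫⁻ ω, ((supHdotNorm T ((2 + n + σ) / 2) fun t => z t ω) ^ l +
      (holderHdotNorm T (1 / 2 - δ) ((n + σ) / 2) fun t => z t ω) ^ l) ∂P < ∞

end

/-! The equation is diagonal in Fourier modes, so everything reduces to scalar paths. Testing
against a plane wave of frequency `k ≠ 0` gives `X t + a ∫₀ᵗ X = b t`, where `a = |k|^{2 lam}` and
`b` is a Brownian coefficient of the noise. In the solenoidal case the wave carries a polarization
orthogonal to `k`; this removes the pressure and still recovers every component of a solenoidal
field (`isWaveTested_isSolenoidal`). The scalar equation is solved pathwise by an explicit formula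
(`eq_ouPath`), so no stochastic integral is needed.

If `b` has Hölder seminorm `H` of order `γ < 1/2`, the formula gives two bounds: `|X| ≲ H a^{-γ}`, a
gain of `2 γ lam` derivatives (`abs_ouPath_le`), and `|X t - X s| ≲ H |t - s|^γ` uniformly in `a`
(`abs_ouPath_sub_le`). Dyadic chaining controls `H` by a weighted sum of powers of dyadic
increments. Its moments are explicit for Gaussian increments, and `H ^ 2` has an `L^p` norm at most
a constant times the variance of `b` (`lintegral_dyadicSum_le`).

Minkowski's inequality in `L^p(Ω)` sums over the modes: the random variable `drivingSum` has a
finite `p`-th moment because the weighted sum of the variances is controlled by the trace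
(`IsDriver.lintegral_drivingSum_lt_top`). Taking `γ` close to `1/2` yields the supremum norm, at a
cost of `(n+2)/2 - lam` derivatives of noise plus a multiple of `σ`; taking `γ = 1/2 - δ` without
using the gain yields the Hölder norm. Measurability of the suprema over uncountably many times
comes from lower semicontinuity of the Sobolev norms. -/

noncomputable section

/-! ### The Ornstein–Uhlenbeck path driven by a Hölder continuous path -/

/-- The solution of `X t + a ∫₀ᵗ X = b t`. -/
def ouPath (a : ℝ) (b : ℝ → ℝ) (t : ℝ) : ℝ :=
  b t - a * ∫ r in (0 : ℝ)..t, Real.exp (-(a * r)) * b (t - r)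

/-- Integrating factor: the primitive `F` of `X` satisfies `(e^{a s} F)' = e^{a s} b`. Only
integrability of `X` is assumed; the equation itself then makes `X = b - a F` continuous, which is
what allows `F` to be differentiated. -/
theorem eq_ouPath {a : ℝ} {b X : ℝ → ℝ} (hb : Continuous b)
    (hX : ∀ t, 0 ≤ t → IntervalIntegrable X volume 0 t ∧ X t + a * ∫ r in (0 : ℝ)..t, X r = b t)
    {t : ℝ} (ht : 0 ≤ t) : X t = ouPath a b t := by
  set F : ℝ → ℝ := fun t => ∫ r in (0 : ℝ)..t, X r with hF
  have hXF : ∀ s, 0 ≤ s → X s = b s - a * F s := fun s hs => by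
    have := (hX s hs).2
    simp only [hF]; linarith
  have hFc : ContinuousOn F (Set.Icc 0 (t + 1)) := by
    have := intervalIntegral.continuousOn_primitive_interval'
      (hX (t + 1) (by linarith)).1 (Set.left_mem_uIcc)
    rwa [Set.uIcc_of_le (by linarith)] at this
  have hXc : ContinuousOn X (Set.Ioo 0 (t + 1)) := by
    refine ContinuousOn.congr (f := fun s => b s - a * F s) ?_ fun s hs => hXF s hs.1.le
    exact hb.continuousOn.sub
      (continuousOn_const.mul (hFc.mono Set.Ioo_subset_Icc_self))
  have hFd : ∀ s ∈ Set.Ioo 0 t, HasDerivAt F (X s) s := fun s hs => by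
    have hs' : s ∈ Set.Ioo 0 (t + 1) := ⟨hs.1, by linarith [hs.2]⟩
    exact intervalIntegral.integral_hasDerivAt_right (hX s hs.1.le).1
      (hXc.stronglyMeasurableAtFilter isOpen_Ioo s hs')
      (hXc.continuousAt (isOpen_Ioo.mem_nhds hs'))
  have key : ∫ s in (0 : ℝ)..t, Real.exp (a * s) * b s =
      Real.exp (a * t) * F t - Real.exp (a * 0) * F 0 := by
    refine intervalIntegral.integral_eq_sub_of_hasDerivAt_of_le
      (f := fun s => Real.exp (a * s) * F s) ht ?_ ?_ ?_
    · exact (by fun_prop : Continuous fun s => Real.exp (a * s)).continuousOn.mul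
        (hFc.mono (Set.Icc_subset_Icc_right (by linarith)))
    · intro s hs
      have h1 : HasDerivAt (fun s => Real.exp (a * s)) (Real.exp (a * s) * a) s := by
        simpa using ((hasDerivAt_id s).const_mul a).exp
      refine (h1.mul (hFd s hs)).congr_deriv ?_
      rw [hXF s hs.1.le]; ring
    · exact (by fun_prop : Continuous fun s => Real.exp (a * s) * b s).intervalIntegrable _ _
  have h0 : F 0 = 0 := by simp [hF]
  have hsub : ∫ r in (0 : ℝ)..t, Real.exp (-(a * r)) * b (t - r) =
      Real.exp (-(a * t)) * ∫ s in (0 : ℝ)..t, Real.exp (a * s) * b s := by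
    have h := intervalIntegral.integral_comp_sub_left
      (fun s => Real.exp (-(a * (t - s))) * b s) t (a := 0) (b := t)
    simp only [sub_sub_cancel, sub_self, sub_zero] at h
    rw [h, ← intervalIntegral.integral_const_mul]
    refine intervalIntegral.integral_congr fun s _ => ?_
    rw [← mul_assoc, ← Real.exp_add]
    ring_nf
  rw [hXF t ht, ouPath, hsub, key, h0, mul_zero, sub_zero, ← mul_assoc (Real.exp _),
    ← Real.exp_add]
  simp

theorem continuous_ouPath {a : ℝ} {b : ℝ → ℝ} (hb : Continuous b) : Continuous (ouPath a b) := by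
  refine hb.sub (continuous_const.mul ?_)
  exact intervalIntegral.continuous_parametric_intervalIntegral_of_continuous
    (f := fun t r => Real.exp (-(a * r)) * b (t - r)) (by fun_prop) continuous_id

theorem integral_mul_exp_neg (a t : ℝ) :
    ∫ r in (0 : ℝ)..t, a * Real.exp (-(a * r)) = 1 - Real.exp (-(a * t)) := by
  have := intervalIntegral.integral_eq_sub_of_hasDerivAt (a := 0) (b := t)
    (f := fun r => -Real.exp (-(a * r))) (f' := fun r => a * Real.exp (-(a * r)))
    (fun r _ => by
      have := (((hasDerivAt_id r).const_mul a).neg.exp).neg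
      refine this.congr_deriv ?_
      simp; ring)
    ((by fun_prop : Continuous fun r => a * Real.exp (-(a * r))).intervalIntegrable _ _)
  rw [this]; simp; ring

/-- Half of the exponential absorbs the power; the other half remains, so that the bound is still
integrable in time. -/
theorem rpow_mul_exp_neg_le {γ x : ℝ} (hγ0 : 0 ≤ γ) (hγ1 : γ ≤ 1) (hx : 0 ≤ x) :
    x ^ γ * Real.exp (-x) ≤ 2 * Real.exp (-(x / 2)) := by
  have h1 : x ^ γ ≤ 1 + x := by
    rcases le_total x 1 with h | h
    · linarith [Real.rpow_le_one hx h hγ0]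
    · have := Real.rpow_le_rpow_of_exponent_le h hγ1
      rw [Real.rpow_one] at this; linarith
  have h2 : 1 + x ≤ 2 * Real.exp (x / 2) := by
    have := Real.add_one_le_exp (x / 2); linarith
  calc x ^ γ * Real.exp (-x) ≤ 2 * Real.exp (x / 2) * Real.exp (-x) := by gcongr; linarith
    _ = 2 * Real.exp (-(x / 2)) := by rw [mul_assoc, ← Real.exp_add]; ring_nf

/-- The kernel `a e^{-a r}` has mass `1 - e^{-a t}`, so `X` is `e^{-a t} b t` plus an average of the
increments `b t - b (t - r)`. The kernel lives at the scale `r ~ 1/a`, where such increments have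
size `H a^{-γ}`. The two pieces contribute `2` and `4` to the constant. -/
theorem abs_ouPath_le {a γ H T : ℝ} {b : ℝ → ℝ} (ha : 0 < a) (hγ0 : 0 ≤ γ) (hγ1 : γ ≤ 1)
    (hH0 : 0 ≤ H) (hb : Continuous b) (hb0 : b 0 = 0)
    (hH : ∀ s t, s ≤ T → t ≤ T → |b t - b s| ≤ H * |t - s| ^ γ) {t : ℝ} (ht0 : 0 ≤ t)
    (htT : t ≤ T) : |ouPath a b t| ≤ 6 * H * a ^ (-γ) := by
  have hag : a ^ (-γ) * a ^ γ = 1 := by rw [← Real.rpow_add ha]; simp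
  have hpow : ∀ r, 0 ≤ r → r ^ γ * Real.exp (-(a * r)) ≤ a ^ (-γ) * (2 * Real.exp (-(a * r / 2))) :=
    fun r hr => by
      have := rpow_mul_exp_neg_le hγ0 hγ1 (mul_nonneg ha.le hr)
      calc r ^ γ * Real.exp (-(a * r)) = a ^ (-γ) * ((a * r) ^ γ * Real.exp (-(a * r))) := by
            rw [Real.mul_rpow ha.le hr, ← mul_assoc, ← mul_assoc, hag, one_mul]
        _ ≤ _ := by gcongr
  have hid : ouPath a b t = Real.exp (-(a * t)) * b t +
      ∫ r in (0 : ℝ)..t, a * Real.exp (-(a * r)) * (b t - b (t - r)) := by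
    have h1 : ∫ r in (0 : ℝ)..t, a * Real.exp (-(a * r)) * (b t - b (t - r)) =
        (∫ r in (0 : ℝ)..t, a * Real.exp (-(a * r))) * b t -
          a * ∫ r in (0 : ℝ)..t, Real.exp (-(a * r)) * b (t - r) := by
      rw [← intervalIntegral.integral_mul_const, ← intervalIntegral.integral_const_mul,
        ← intervalIntegral.integral_sub]
      · exact intervalIntegral.integral_congr fun r _ => by ring
      · exact (by fun_prop : Continuous _).intervalIntegrable _ _
      · exact (by fun_prop : Continuous _).intervalIntegrable _ _
    rw [h1, integral_mul_exp_neg, ouPath]; ring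
  have hA : |Real.exp (-(a * t)) * b t| ≤ 2 * H * a ^ (-γ) := by
    have h1 := hH 0 t (ht0.trans htT) htT
    rw [hb0, sub_zero, sub_zero, abs_of_nonneg ht0] at h1
    rw [abs_mul, abs_of_pos (Real.exp_pos _)]
    have h2 : Real.exp (-(a * t / 2)) ≤ 1 := Real.exp_le_one_iff.2 (by
      have := mul_nonneg ha.le ht0; linarith)
    calc Real.exp (-(a * t)) * |b t| ≤ Real.exp (-(a * t)) * (H * t ^ γ) := by gcongr
      _ = H * (t ^ γ * Real.exp (-(a * t))) := by ring
      _ ≤ H * (a ^ (-γ) * (2 * 1)) := by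
          refine mul_le_mul_of_nonneg_left ((hpow t ht0).trans ?_) hH0
          gcongr
      _ = _ := by ring
  have hB : |∫ r in (0 : ℝ)..t, a * Real.exp (-(a * r)) * (b t - b (t - r))| ≤
      4 * H * a ^ (-γ) := by
    have h1 : ‖∫ r in (0 : ℝ)..t, a * Real.exp (-(a * r)) * (b t - b (t - r))‖ ≤
        ∫ r in (0 : ℝ)..t, 4 * H * a ^ (-γ) * (a / 2 * Real.exp (-(a / 2 * r))) := by
      refine intervalIntegral.norm_integral_le_of_norm_le ht0 ?_
        ((by fun_prop : Continuous _).intervalIntegrable _ _)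
      refine Eventually.of_forall fun r hr => ?_
      have h2 := hH (t - r) t (by linarith [hr.1]) htT
      rw [sub_sub_cancel, abs_of_pos hr.1] at h2
      rw [Real.norm_eq_abs, abs_mul, abs_of_nonneg (by positivity : 0 ≤ a * Real.exp (-(a * r)))]
      calc a * Real.exp (-(a * r)) * |b t - b (t - r)|
          ≤ a * Real.exp (-(a * r)) * (H * r ^ γ) := by gcongr
        _ = a * H * (r ^ γ * Real.exp (-(a * r))) := by ring
        _ ≤ a * H * (a ^ (-γ) * (2 * Real.exp (-(a * r / 2)))) := by
            have := hpow r hr.1.le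
            gcongr
        _ = _ := by rw [show a * r / 2 = a / 2 * r by ring]; ring
    rw [intervalIntegral.integral_const_mul, integral_mul_exp_neg] at h1
    refine h1.trans ?_
    have : 0 ≤ 4 * H * a ^ (-γ) := by positivity
    nlinarith [Real.exp_pos (-(a / 2 * t))]
  rw [hid]
  refine (abs_add_le _ _).trans ?_
  linarith

/-- As `b` vanishes at negative times, both convolutions can be taken over `[0, t]`. The difference
is then an increment of `b` minus an average of increments over the same time lag, with a kernel of
mass at most `1`; hence a constant independent of `a`. -/
theorem abs_ouPath_sub_le {a γ H T : ℝ} {b : ℝ → ℝ} (ha : 0 < a)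
    (hH0 : 0 ≤ H) (hb : Continuous b) (hb0 : ∀ t ≤ 0, b t = 0)
    (hH : ∀ s t, s ≤ T → t ≤ T → |b t - b s| ≤ H * |t - s| ^ γ) {s t : ℝ} (hs0 : 0 ≤ s)
    (hst : s ≤ t) (htT : t ≤ T) : |ouPath a b t - ouPath a b s| ≤ 2 * H * |t - s| ^ γ := by
  have hc : ∀ u, Continuous fun r => Real.exp (-(a * r)) * b (u - r) := fun u => by fun_prop
  have hext : ∫ r in (0 : ℝ)..s, Real.exp (-(a * r)) * b (s - r) =
      ∫ r in (0 : ℝ)..t, Real.exp (-(a * r)) * b (s - r) := by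
    rw [← intervalIntegral.integral_add_adjacent_intervals ((hc s).intervalIntegrable 0 s)
      ((hc s).intervalIntegrable s t)]
    have : ∫ r in s..t, Real.exp (-(a * r)) * b (s - r) = ∫ r in s..t, (0 : ℝ) := by
      refine intervalIntegral.integral_congr fun r hr => ?_
      rw [Set.uIcc_of_le hst] at hr
      rw [hb0 _ (by linarith [hr.1]), mul_zero]
    rw [this]; simp
  have hid : ouPath a b t - ouPath a b s = (b t - b s) -
      ∫ r in (0 : ℝ)..t, a * Real.exp (-(a * r)) * (b (t - r) - b (s - r)) := by
    have h1 : ∫ r in (0 : ℝ)..t, a * Real.exp (-(a * r)) * (b (t - r) - b (s - r)) =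
        a * (∫ r in (0 : ℝ)..t, Real.exp (-(a * r)) * b (t - r)) -
          a * ∫ r in (0 : ℝ)..t, Real.exp (-(a * r)) * b (s - r) := by
      rw [← intervalIntegral.integral_const_mul, ← intervalIntegral.integral_const_mul,
        ← intervalIntegral.integral_sub (((hc t).const_mul a).intervalIntegrable _ _)
          (((hc s).const_mul a).intervalIntegrable _ _)]
      exact intervalIntegral.integral_congr fun r _ => by ring
    rw [h1, ouPath, ouPath, hext]; ring
  have ht0 : 0 ≤ t := hs0.trans hst
  have hB : |∫ r in (0 : ℝ)..t, a * Real.exp (-(a * r)) * (b (t - r) - b (s - r))| ≤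
      H * |t - s| ^ γ := by
    have h1 : ‖∫ r in (0 : ℝ)..t, a * Real.exp (-(a * r)) * (b (t - r) - b (s - r))‖ ≤
        ∫ r in (0 : ℝ)..t, H * |t - s| ^ γ * (a * Real.exp (-(a * r))) := by
      refine intervalIntegral.norm_integral_le_of_norm_le ht0 ?_
        ((by fun_prop : Continuous _).intervalIntegrable _ _)
      refine Eventually.of_forall fun r hr => ?_
      have h2 := hH (s - r) (t - r) (by linarith [hr.1]) (by linarith [hr.1])
      rw [sub_sub_sub_cancel_right] at h2
      rw [Real.norm_eq_abs, abs_mul, abs_of_nonneg (by positivity : 0 ≤ a * Real.exp (-(a * r))),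
        mul_comm]
      gcongr
    rw [intervalIntegral.integral_const_mul, integral_mul_exp_neg] at h1
    refine h1.trans ?_
    have : 0 ≤ H * |t - s| ^ γ := by positivity
    nlinarith [Real.exp_pos (-(a * t))]
  rw [hid]
  have := hH s t (hst.trans htT) htT
  refine (abs_sub _ _).trans ?_
  linarith
end

noncomputable section

/-! ### Dyadic chaining -/

theorem tendsto_dyadic_floor {t : ℝ} (ht : 0 ≤ t) :
    Tendsto (fun m : ℕ => (⌊t * 2 ^ m⌋₊ : ℝ) / 2 ^ m) atTop (𝓝 t) :=
  (tendsto_nat_floor_mul_div_atTop ht).comp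
    (tendsto_pow_atTop_atTop_of_one_lt (one_lt_two : (1 : ℝ) < 2))

/-- Chaining: the dyadic floors of `t` at two consecutive levels agree or are neighbours at the
finer level, so going from the floor at level `m` to `t` costs a geometric series. The floors of `s`
and `t` at a level adapted to `t - s` differ by at most one cell. -/
theorem abs_sub_le_of_dyadic_unit {g : ℝ → ℝ} {A γ : ℝ} (hg : Continuous g) (hA : 0 ≤ A)
    (hγ : 0 < γ)
    (hK : ∀ m j : ℕ, j < 2 ^ m →
      |g (((j : ℝ) + 1) / 2 ^ m) - g ((j : ℝ) / 2 ^ m)| ≤ A * ((2 : ℝ) ^ (-γ)) ^ m)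
    {s t : ℝ} (hs : 0 ≤ s) (hst : s ≤ t) (ht : t ≤ 1) :
    |g t - g s| ≤ (1 + 2 * (2 : ℝ) ^ (-γ) / (1 - (2 : ℝ) ^ (-γ))) * 2 ^ γ * A * (t - s) ^ γ := by
  set ρ : ℝ := (2 : ℝ) ^ (-γ) with hρ
  have hρ0 : 0 < ρ := by positivity
  have hρ1 : ρ < 1 := Real.rpow_lt_one_of_one_lt_of_neg one_lt_two (by linarith)
  have hstep : ∀ t : ℝ, 0 ≤ t → t ≤ 1 → ∀ m : ℕ,
      dist (g ((⌊t * 2 ^ m⌋₊ : ℝ) / 2 ^ m)) (g ((⌊t * 2 ^ (m + 1)⌋₊ : ℝ) / 2 ^ (m + 1))) ≤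
        A * ρ * ρ ^ m := by
    intro t ht0 ht1 m
    set f := ⌊t * 2 ^ m⌋₊ with hf
    set f' := ⌊t * 2 ^ (m + 1)⌋₊ with hf'
    have h1 : (f : ℝ) ≤ t * 2 ^ m := Nat.floor_le (by positivity)
    have h2 : t * 2 ^ m < f + 1 := Nat.lt_floor_add_one _
    have h3 : (f' : ℝ) ≤ t * 2 ^ (m + 1) := Nat.floor_le (by positivity)
    have h4 : t * 2 ^ (m + 1) < f' + 1 := Nat.lt_floor_add_one _
    rw [pow_succ] at h3 h4
    have h5 : f' < 2 * f + 2 := by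
      have : (f' : ℝ) < 2 * f + 2 := by linarith
      exact_mod_cast this
    have h6 : 2 * f < f' + 1 := by
      have : (2 * f : ℝ) < f' + 1 := by linarith
      exact_mod_cast this
    have hdiv : (f : ℝ) / 2 ^ m = ((2 * f : ℕ) : ℝ) / 2 ^ (m + 1) := by
      push_cast; rw [pow_succ]; field_simp
    rcases (by omega : f' = 2 * f ∨ f' = 2 * f + 1) with h | h
    · rw [h, hdiv, dist_self]; positivity
    · have h7 : 2 * f < 2 ^ (m + 1) := by
        have : (f' : ℝ) ≤ 2 ^ (m + 1) := by
          rw [pow_succ]; nlinarith [pow_pos (two_pos : (0 : ℝ) < 2) m]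
        have : f' ≤ 2 ^ (m + 1) := by exact_mod_cast this
        omega
      have := hK (m + 1) (2 * f) h7
      rw [hdiv, dist_comm, Real.dist_eq, h]
      calc _ ≤ A * ρ ^ (m + 1) := by
            convert this using 4
            push_cast; rfl
        _ = _ := by rw [pow_succ]; ring
  have hlim : ∀ t : ℝ, 0 ≤ t → t ≤ 1 → ∀ m : ℕ,
      |g ((⌊t * 2 ^ m⌋₊ : ℝ) / 2 ^ m) - g t| ≤ A * ρ * ρ ^ m / (1 - ρ) := fun t ht0 ht1 m => by
    rw [← Real.dist_eq]
    exact dist_le_of_le_geometric_of_tendsto ρ (A * ρ) hρ1 (hstep t ht0 ht1)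
      ((hg.tendsto t).comp (tendsto_dyadic_floor ht0)) m
  rcases hst.eq_or_lt with rfl | hlt
  · simp [Real.zero_rpow hγ.ne']
  -- Here `2^{-(m+1)} < t - s ≤ 2^{-m}`: the upper bound makes the floors at level `m` equal or
  -- adjacent, the lower one turns `ρ ^ m` into a multiple of `(t - s) ^ γ`.
  obtain ⟨m, hm1, hm2⟩ := exists_nat_pow_near_of_lt_one (x := t - s) (y := (1 / 2 : ℝ))
    (by linarith) (by linarith) (by norm_num) (by norm_num)
  have hmid : |g ((⌊t * 2 ^ m⌋₊ : ℝ) / 2 ^ m) - g ((⌊s * 2 ^ m⌋₊ : ℝ) / 2 ^ m)| ≤ A * ρ ^ m := by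
    have h1 : ⌊s * 2 ^ m⌋₊ ≤ ⌊t * 2 ^ m⌋₊ := Nat.floor_mono (by gcongr)
    have h2 : ⌊t * 2 ^ m⌋₊ ≤ ⌊s * 2 ^ m⌋₊ + 1 := by
      rw [← Nat.floor_add_one (by positivity)]
      refine Nat.floor_mono ?_
      have : (t - s) * 2 ^ m ≤ 1 := by
        calc (t - s) * 2 ^ m ≤ (1 / 2) ^ m * 2 ^ m := by gcongr
          _ = 1 := by rw [← mul_pow]; norm_num
      linarith
    rcases (by omega : ⌊t * 2 ^ m⌋₊ = ⌊s * 2 ^ m⌋₊ ∨ ⌊t * 2 ^ m⌋₊ = ⌊s * 2 ^ m⌋₊ + 1) with h | h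
    · rw [h, sub_self, abs_zero]; positivity
    · have h7 : ⌊s * 2 ^ m⌋₊ < 2 ^ m := by
        have h8 : (⌊t * 2 ^ m⌋₊ : ℝ) ≤ t * 2 ^ m :=
          Nat.floor_le (mul_nonneg (hs.trans hst) (by positivity))
        have : (⌊t * 2 ^ m⌋₊ : ℝ) ≤ 2 ^ m :=
          h8.trans (mul_le_of_le_one_left (by positivity) ht)
        have : ⌊t * 2 ^ m⌋₊ ≤ 2 ^ m := by exact_mod_cast this
        omega
      have := hK m _ h7
      rw [h]; push_cast; exact this
  have hρm : ρ ^ m ≤ 2 ^ γ * (t - s) ^ γ := by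
    rw [← Real.mul_rpow two_pos.le (by linarith)]
    calc ρ ^ m = ((1 / 2 : ℝ) ^ m) ^ γ := by
          rw [hρ, Real.rpow_neg two_pos.le, ← Real.inv_rpow two_pos.le, ← Real.rpow_natCast,
            ← Real.rpow_mul (by norm_num), mul_comm, Real.rpow_mul (by norm_num),
            Real.rpow_natCast]
          norm_num
      _ ≤ (2 * (t - s)) ^ γ := by
          refine Real.rpow_le_rpow (by positivity) ?_ hγ.le
          rw [pow_succ] at hm1; linarith
  have ha := hlim t (hs.trans hst) ht m
  have hb := hlim s hs (hst.trans ht) m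
  have h1ρ : 0 < 1 - ρ := by linarith
  calc |g t - g s| ≤ A * ρ * ρ ^ m / (1 - ρ) + A * ρ ^ m + A * ρ * ρ ^ m / (1 - ρ) := by
        rw [abs_le] at *
        constructor <;> linarith [ha.1, ha.2, hb.1, hb.2, hmid.1, hmid.2]
    _ = (1 + 2 * ρ / (1 - ρ)) * A * ρ ^ m := by field_simp; ring
    _ ≤ (1 + 2 * ρ / (1 - ρ)) * A * (2 ^ γ * (t - s) ^ γ) := by gcongr
    _ = _ := by ring

/-- The constant of the dyadic chaining estimate. -/
def chainConst (T γ : ℝ) : ℝ :=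
  (1 + 2 * (2 : ℝ) ^ (-γ) / (1 - (2 : ℝ) ^ (-γ))) * 2 ^ γ * (T ^ γ)⁻¹

theorem chainConst_pos {T γ : ℝ} (hT : 0 < T) (hγ : 0 < γ) : 0 < chainConst T γ := by
  have hρ1 : (2 : ℝ) ^ (-γ) < 1 := Real.rpow_lt_one_of_one_lt_of_neg one_lt_two (by linarith)
  have : 0 < 1 - (2 : ℝ) ^ (-γ) := by linarith
  unfold chainConst; positivity

theorem abs_sub_le_of_dyadic {b : ℝ → ℝ} {A γ T : ℝ} (hb : Continuous b) (hA : 0 ≤ A)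
    (hγ : 0 < γ) (hT : 0 < T)
    (hK : ∀ m j : ℕ, j < 2 ^ m →
      |b (((j : ℝ) + 1) / 2 ^ m * T) - b ((j : ℝ) / 2 ^ m * T)| ≤ A * ((2 : ℝ) ^ (-γ)) ^ m)
    {s t : ℝ} (hs0 : 0 ≤ s) (hsT : s ≤ T) (ht0 : 0 ≤ t) (htT : t ≤ T) :
    |b t - b s| ≤ chainConst T γ * A * |t - s| ^ γ := by
  wlog hst : s ≤ t generalizing s t
  · rw [abs_sub_comm, abs_sub_comm t s]
    exact this ht0 htT hs0 hsT (le_of_not_ge hst)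
  have h := abs_sub_le_of_dyadic_unit (g := fun u => b (u * T)) (by fun_prop) hA hγ hK
    (s := s / T) (t := t / T) (by positivity) (by gcongr) (by rw [div_le_one hT]; exact htT)
  simp only [div_mul_cancel₀ _ hT.ne'] at h
  rw [← sub_div, Real.div_rpow (by linarith) hT.le] at h
  rw [abs_of_nonneg (sub_nonneg.2 hst), chainConst]
  refine h.trans_eq ?_
  rw [div_eq_mul_inv]; ring

/-- The weighted sum of the `2 p`-th powers of the dyadic increments of `β` on `[0, T]`, which
controls its Hölder seminorm of order `γ`. -/
def dyadicSum (T : ℝ≥0) (γ : ℝ) (p : ℕ) (β : ℝ≥0 → ℝ) : ℝ≥0∞ :=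
  ∑' m : ℕ, ENNReal.ofReal (((2 : ℝ) ^ γ) ^ m) ^ (2 * p) * ∑ j ∈ Finset.range (2 ^ m),
    ‖β (((j : ℝ≥0) + 1) / 2 ^ m * T) - β ((j : ℝ≥0) / 2 ^ m * T)‖ₑ ^ (2 * p)

/-- Each increment is a single term of the sum, hence at most its `2 p`-th root after weighting;
chaining does the rest. -/
theorem abs_sub_le_dyadicSum {β : ℝ≥0 → ℝ} {T : ℝ≥0} {γ : ℝ} {p : ℕ} (hβ : Continuous β)
    (hγ : 0 < γ) (hT : 0 < T) (hp : p ≠ 0) (hS : dyadicSum T γ p β ≠ ∞) {s t : ℝ≥0} (hs : s ≤ T)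
    (ht : t ≤ T) :
    |β t - β s| ≤ chainConst T γ * (dyadicSum T γ p β).toReal ^ ((2 * p : ℕ) : ℝ)⁻¹ *
      |(t : ℝ) - s| ^ γ := by
  set S := dyadicSum T γ p β with hSdef
  have h2p : 2 * p ≠ 0 := by omega
  have key := abs_sub_le_of_dyadic (b := fun u => β u.toNNReal) (A := S.toReal ^ ((2 * p : ℕ) : ℝ)⁻¹)
    (T := T) (γ := γ) (by fun_prop) (by positivity) hγ hT ?_ (s := s) (t := t) s.2 hs t.2 ht
  · simpa using key
  intro m j hj
  have e1 : (((j : ℝ) + 1) / 2 ^ m * T).toNNReal = ((j : ℝ≥0) + 1) / 2 ^ m * T := by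
    rw [← Real.toNNReal_coe (r := ((j : ℝ≥0) + 1) / 2 ^ m * T)]; push_cast; rfl
  have e2 : ((j : ℝ) / 2 ^ m * T).toNNReal = (j : ℝ≥0) / 2 ^ m * T := by
    rw [← Real.toNNReal_coe (r := (j : ℝ≥0) / 2 ^ m * T)]; push_cast; rfl
  simp only [e1, e2]
  set Δ := β (((j : ℝ≥0) + 1) / 2 ^ m * T) - β ((j : ℝ≥0) / 2 ^ m * T) with hΔ
  have h1 : ENNReal.ofReal ((((2 : ℝ) ^ γ) ^ m * |Δ|) ^ (2 * p)) ≤ S := by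
    rw [ENNReal.ofReal_pow (by positivity), ENNReal.ofReal_mul (by positivity), mul_pow,
      ← Real.enorm_eq_ofReal_abs]
    refine le_trans ?_ (ENNReal.le_tsum m)
    gcongr
    exact Finset.single_le_sum (f := fun j : ℕ =>
      ‖β (((j : ℝ≥0) + 1) / 2 ^ m * T) - β ((j : ℝ≥0) / 2 ^ m * T)‖ₑ ^ (2 * p))
      (fun _ _ => zero_le) (Finset.mem_range.2 hj)
  have h2 : (((2 : ℝ) ^ γ) ^ m * |Δ|) ^ (2 * p) ≤ S.toReal := (ENNReal.ofReal_le_iff_le_toReal hS).1 h1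
  have h3 : ((2 : ℝ) ^ γ) ^ m * |Δ| ≤ S.toReal ^ ((2 * p : ℕ) : ℝ)⁻¹ := by
    rw [← Real.pow_rpow_inv_natCast (x := ((2 : ℝ) ^ γ) ^ m * |Δ|) (by positivity) h2p]
    exact Real.rpow_le_rpow (by positivity) h2 (by positivity)
  rw [Real.rpow_neg two_pos.le, inv_pow, ← div_eq_mul_inv, le_div_iff₀ (by positivity), mul_comm]
  exact h3

/-! ### Moments of the dyadic increments of a Brownian motion -/

/-- The `2 p`-th moment of the standard normal law. -/
def gaussianMoment (p : ℕ) : ℝ≥0∞ := ∫⁻ x, ‖x‖ₑ ^ (2 * p) ∂(gaussianReal 0 1)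

theorem gaussianMoment_lt_top {p : ℕ} (hp : p ≠ 0) : gaussianMoment p < ∞ := by
  have h := (memLp_id_gaussianReal (μ := 0) (v := 1) ((2 * p : ℕ) : ℝ≥0)).eLpNorm_lt_top
  rw [eLpNorm_lt_top_iff_lintegral_rpow_enorm_lt_top (by simpa using hp)
    ENNReal.coe_ne_top] at h
  simpa [gaussianMoment, ← ENNReal.rpow_natCast] using h

/-- Scaling the standard normal law by the square root of the variance. -/
theorem lintegral_gaussianReal_pow (p : ℕ) (v : ℝ≥0) :
    ∫⁻ x, ‖x‖ₑ ^ (2 * p) ∂(gaussianReal 0 v) = v ^ p * gaussianMoment p := by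
  have h := gaussianReal_map_const_mul (μ := 0) (v := 1) (NNReal.sqrt v : ℝ)
  have hv : (NNReal.mk ((NNReal.sqrt v : ℝ) ^ 2) (sq_nonneg _)) * 1 = v := by
    rw [mul_one]; ext; simp
  rw [mul_zero, hv] at h
  rw [← h, lintegral_map (by fun_prop) (by fun_prop), gaussianMoment,
    ← lintegral_const_mul _ (by fun_prop)]
  refine lintegral_congr fun x => ?_
  rw [enorm_mul, mul_pow, pow_mul]
  congr 2
  rw [enorm_eq_nnnorm, NNReal.nnnorm_eq, ← ENNReal.coe_pow, NNReal.sq_sqrt]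

theorem aemeasurable_dyadicSum {Ω : Type*} [MeasurableSpace Ω] {P : Measure Ω}
    {β : ℝ≥0 → Ω → ℝ} (hm : ∀ t, AEMeasurable (β t) P) (T : ℝ≥0) (γ : ℝ) (p : ℕ) :
    AEMeasurable (fun ω => dyadicSum T γ p fun t => β t ω) P := by
  refine AEMeasurable.tsum fun m => ?_
  refine AEMeasurable.const_mul (Finset.aemeasurable_fun_sum _ fun j _ => ?_) _
  exact (((hm _).sub (hm _)).enorm).pow_const _

/-- The constant of the moment bound for `dyadicSum`. -/
def dyadicConst (T : ℝ≥0) (γ : ℝ) (p : ℕ) : ℝ≥0∞ :=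
  gaussianMoment p * T ^ p * ∑' m : ℕ, ENNReal.ofReal ((2 : ℝ) ^ (2 * p * γ + 1 - p)) ^ m

/-- The condition on `p` says exactly that the geometric ratio is below `1`. -/
theorem dyadicConst_lt_top (T : ℝ≥0) {γ : ℝ} {p : ℕ} (hp : p ≠ 0) (hγ : 1 < p * (1 - 2 * γ)) :
    dyadicConst T γ p < ∞ := by
  refine ENNReal.mul_lt_top (ENNReal.mul_lt_top (gaussianMoment_lt_top hp) (by simp)) ?_
  rw [ENNReal.tsum_geometric]
  refine ENNReal.inv_lt_top.2 (tsub_pos_of_lt ?_)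
  rw [ENNReal.ofReal_lt_one]
  exact Real.rpow_lt_one_of_one_lt_of_neg one_lt_two (by linarith)

/-- Level `m` has `2^m` increments of variance `2^{-m} T v` with weight `2^{2 p γ m}`, so it
contributes the `m`-th power of `2^{2 p γ + 1 - p}`. -/
theorem lintegral_dyadicSum_le {Ω : Type*} [MeasurableSpace Ω] {P : Measure Ω}
    {β : ℝ≥0 → Ω → ℝ} {v : ℝ≥0} (hm : ∀ t, AEMeasurable (β t) P)
    (hg : ∀ s t : ℝ≥0, s ≤ t → P.map (fun ω => β t ω - β s ω) = gaussianReal 0 ((t - s) * v))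
    (T : ℝ≥0) (γ : ℝ) (p : ℕ) :
    ∫⁻ ω, dyadicSum T γ p (fun t => β t ω) ∂P ≤ dyadicConst T γ p * v ^ p := by
  have hinc : ∀ m j : ℕ, ∫⁻ ω, ‖β (((j : ℝ≥0) + 1) / 2 ^ m * T) ω - β ((j : ℝ≥0) / 2 ^ m * T) ω‖ₑ
      ^ (2 * p) ∂P = ((T / 2 ^ m * v : ℝ≥0) : ℝ≥0∞) ^ p * gaussianMoment p := fun m j => by
    rw [← lintegral_gaussianReal_pow]
    have hle : (j : ℝ≥0) / 2 ^ m * T ≤ ((j : ℝ≥0) + 1) / 2 ^ m * T := by gcongr; simp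
    have hd : ((j : ℝ≥0) + 1) / 2 ^ m * T - (j : ℝ≥0) / 2 ^ m * T = T / 2 ^ m := by
      rw [add_div, add_mul, add_tsub_cancel_left]; ring
    have := hg _ _ hle
    rw [hd] at this
    rw [← this, lintegral_map' (by fun_prop) (AEMeasurable.fun_sub (hm _) (hm _))]
  have hmeas : ∀ m j : ℕ, AEMeasurable (fun ω =>
      ‖β (((j : ℝ≥0) + 1) / 2 ^ m * T) ω - β ((j : ℝ≥0) / 2 ^ m * T) ω‖ₑ ^ (2 * p)) P :=
    fun m j => (((hm _).sub (hm _)).enorm).pow_const _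
  simp only [dyadicSum]
  rw [lintegral_tsum fun m => (Finset.aemeasurable_fun_sum _ fun j _ => hmeas m j).const_mul _,
    dyadicConst, ← ENNReal.tsum_mul_left,
    ← ENNReal.tsum_mul_right]
  refine ENNReal.tsum_le_tsum fun m => le_of_eq ?_
  rw [lintegral_const_mul'' _ (Finset.aemeasurable_fun_sum _ fun j _ => hmeas m j),
    lintegral_finsetSum' _ fun j _ => hmeas m j]
  simp only [hinc, Finset.sum_const, Finset.card_range, nsmul_eq_mul]
  have hr : (ENNReal.ofReal (((2 : ℝ) ^ γ) ^ m)) ^ (2 * p) * ((2 ^ m : ℕ) : ℝ≥0∞) *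
      ENNReal.ofReal ((2 ^ m)⁻¹) ^ p = ENNReal.ofReal ((2 : ℝ) ^ (2 * p * γ + 1 - p)) ^ m := by
    rw [← ENNReal.ofReal_natCast, ← ENNReal.ofReal_pow (by positivity),
      ← ENNReal.ofReal_pow (by positivity), ← ENNReal.ofReal_pow (by positivity),
      ← ENNReal.ofReal_mul (by positivity), ← ENNReal.ofReal_mul (by positivity)]
    congr 1
    push_cast
    simp only [← Real.rpow_natCast, ← Real.rpow_mul two_pos.le, ← Real.rpow_neg two_pos.le,
      ← Real.rpow_add two_pos]
    congr 1
    push_cast; ring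
  have hd : ((T / 2 ^ m * v : ℝ≥0) : ℝ≥0∞) = T * v * ENNReal.ofReal ((2 ^ m)⁻¹) := by
    rw [ENNReal.ofReal, ← ENNReal.coe_mul, ← ENNReal.coe_mul, ENNReal.coe_inj,
      Real.toNNReal_inv, Real.toNNReal_pow two_pos.le, div_eq_mul_inv]
    simp only [Real.toNNReal_ofNat]
    ring
  rw [hd, mul_pow, mul_pow, ← hr]
  ring
end

noncomputable section

/-! ### Fourier coefficients and trigonometric fields -/

variable {n d : ℕ}

theorem character_neg (k : Fin n → ℤ) (x : Torus n) :
    character (-k) x = (starRingEnd ℂ) (character k x) := by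
  simp [character, map_prod]

theorem character_add (k l : Fin n → ℤ) (x : Torus n) :
    character (k + l) x = character k x * character l x := by
  simp only [character, ContinuousMap.coe_mk, Pi.add_apply, fourier_add, Finset.prod_mul_distrib]

theorem integral_character_eq_zero {k : Fin n → ℤ} (hk : k ≠ 0) :
    ∫ x : Torus n, character k x = 0 := by
  obtain ⟨i, hi⟩ := Function.ne_iff.mp hk
  simp only [character, ContinuousMap.coe_mk]
  rw [MeasureTheory.integral_fintype_prod_volume_eq_prod
    (f := fun i (y : AddCircle (2 * Real.pi)) => (fourier (k i) y : ℂ))]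
  refine Finset.prod_eq_zero (Finset.mem_univ i) ?_
  have h := congrFun (fourierCoeff_fourier (T := 2 * Real.pi) (k i)) 0
  rw [Pi.single_eq_of_ne (by simpa using hi.symm)] at h
  simp only [fourierCoeff, neg_zero, fourier_zero, one_smul] at h
  rw [AddCircle.volume_eq_smul_haarAddCircle, integral_smul_measure, h, smul_zero]

/-- The fields `cos (k · x) e_c` and `sin (k · x) e_c`. -/
def waveField (e : Bool) (k : Fin n → ℤ) (c : Fin d) : L2Field n d :=
  match e with
  | true => cosField k c
  | false => sinField k c

/-- The functions `cos (k · x)` and `sin (k · x)`. -/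
def wave (e : Bool) (k : Fin n → ℤ) (x : Torus n) : ℝ :=
  match e with
  | true => (character k x).re
  | false => (character k x).im

theorem continuous_wave (e : Bool) (k : Fin n → ℤ) : Continuous (wave e k) := by
  cases e
  · exact Complex.continuous_im.comp (character k).continuous
  · exact Complex.continuous_re.comp (character k).continuous

theorem coeFn_waveField (e : Bool) (k : Fin n → ℤ) (c : Fin d) :
    ⇑(waveField e k c) =ᵐ[volume] fun x => wave e k x • EuclideanSpace.single c (1 : ℝ) := by
  cases e
  · exact ContinuousMap.coeFn_toLp (𝕜 := ℝ) (p := 2) volume _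
  · exact ContinuousMap.coeFn_toLp (𝕜 := ℝ) (p := 2) volume _

theorem inner_waveField (f : L2Field n d) (e : Bool) (k : Fin n → ℤ) (c : Fin d) :
    inner ℝ f (waveField e k c) = ∫ x : Torus n, wave e k x * f x c := by
  rw [L2.inner_def]
  refine integral_congr_ae ?_
  filter_upwards [coeFn_waveField e k c] with x hx
  rw [hx, real_inner_smul_right]
  simp [EuclideanSpace.inner_single_right]

theorem integrable_component (f : L2Field n d) (c : Fin d) : Integrable fun x => f x c := by
  have h := (Lp.memLp f).integrable (one_le_two)
  exact (EuclideanSpace.proj (𝕜 := ℝ) c).integrable_comp h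

theorem integrable_wave_mul (f : L2Field n d) (e : Bool) (k : Fin n → ℤ) (c : Fin d) :
    Integrable fun x => wave e k x * f x c := by
  refine (integrable_component f c).bdd_mul (c := 1)
    (continuous_wave e k).aestronglyMeasurable (Eventually.of_forall fun x => ?_)
  have h : ‖character k x‖ = 1 := by
    simp only [character, ContinuousMap.coe_mk, norm_prod, fourier_apply]
    exact Finset.prod_eq_one fun _ _ => Circle.norm_coe _
  cases e
  · exact (Complex.abs_im_le_norm _).trans h.le
  · exact (Complex.abs_re_le_norm _).trans h.le

theorem fieldCoeff_eq_inner (f : L2Field n d) (k : Fin n → ℤ) (c : Fin d) :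
    fieldCoeff f k c = ((2 * Real.pi : ℂ) ^ n)⁻¹ *
      ((inner ℝ f (waveField true k c) : ℝ) - (inner ℝ f (waveField false k c) : ℝ) * Complex.I) := by
  rw [fieldCoeff, inner_waveField, inner_waveField, ← integral_complex_ofReal,
    ← integral_complex_ofReal, ← integral_mul_const, ← integral_sub
      (integrable_wave_mul f true k c).ofReal
      ((integrable_wave_mul f false k c).ofReal.mul_const _)]
  congr 1
  refine integral_congr_ae (Eventually.of_forall fun x => ?_)
  simp only [character_neg, wave]
  rw [← Complex.re_add_im (character k x)]
  simp only [map_add, map_mul, Complex.conj_ofReal, Complex.conj_I, Complex.add_re, Complex.add_im,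
    Complex.mul_re, Complex.mul_im, Complex.ofReal_re, Complex.ofReal_im, Complex.I_re,
    Complex.I_im]
  push_cast; ring

theorem fieldCoeff_smul (r : ℝ) (f : L2Field n d) (k : Fin n → ℤ) (c : Fin d) :
    fieldCoeff (r • f) k c = r * fieldCoeff f k c := by
  simp only [fieldCoeff_eq_inner, real_inner_smul_left]
  push_cast; ring

theorem fieldCoeff_sum {ι : Type*} (s : Finset ι) (f : ι → L2Field n d) (k : Fin n → ℤ)
    (c : Fin d) : fieldCoeff (∑ i ∈ s, f i) k c = ∑ i ∈ s, fieldCoeff (f i) k c := by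
  simp only [fieldCoeff_eq_inner, sum_inner]
  push_cast
  rw [← Finset.mul_sum, Finset.sum_sub_distrib, Finset.sum_mul]

theorem enorm_fieldCoeff_sq (f : L2Field n d) (k : Fin n → ℤ) (c : Fin d) :
    ‖fieldCoeff f k c‖ₑ ^ 2 = ENNReal.ofReal ((((2 * Real.pi) ^ n)⁻¹) ^ 2 *
      (inner ℝ f (waveField true k c) ^ 2 + inner ℝ f (waveField false k c) ^ 2)) := by
  rw [← ofReal_norm, ← ENNReal.ofReal_pow (norm_nonneg _), fieldCoeff_eq_inner, norm_mul,
    mul_pow]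
  congr 2
  · rw [norm_inv, norm_pow, show (2 * Real.pi : ℂ) = ((2 * Real.pi : ℝ) : ℂ) by push_cast; rfl,
      Complex.norm_of_nonneg Real.two_pi_pos.le]
  · rw [← Complex.normSq_eq_norm_sq, Complex.normSq_apply]
    simp; ring

/-- The Fourier coefficients of `cos (k · x)` and `sin (k · x)`. -/
def waveCoeff (e : Bool) (k l : Fin n → ℤ) : ℂ :=
  ((2 * Real.pi : ℂ) ^ n)⁻¹ * ∫ x : Torus n, character (-l) x * (wave e k x : ℂ)

/-- Both waves are combinations of the characters of frequencies `k` and `-k`. -/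
theorem waveCoeff_eq_zero (e : Bool) {k l : Fin n → ℤ} (h : l ≠ k) (h' : l ≠ -k) :
    waveCoeff e k l = 0 := by
  have hint : ∀ k : Fin n → ℤ, Integrable fun x : Torus n => character k x := fun k =>
    (character k).continuous.integrable_of_hasCompactSupport
      (HasCompactSupport.of_compactSpace _)
  have h1 : ∫ x : Torus n, character (-l + k) x = 0 :=
    integral_character_eq_zero fun h0 => h (neg_add_eq_zero.1 h0)
  have h2 : ∫ x : Torus n, character (-l + -k) x = 0 :=
    integral_character_eq_zero fun h0 => h' (neg_add_eq_zero.1 h0)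
  rw [waveCoeff]
  refine mul_eq_zero_of_right _ ?_
  cases e
  · have : ∀ x : Torus n, character (-l) x * (wave false k x : ℂ) =
        (-Complex.I / 2) * (character (-l + k) x - character (-l + -k) x) := fun x => by
      rw [character_add, character_add, character_neg k, wave, ← mul_sub, Complex.sub_conj]
      push_cast
      linear_combination ((character (-l) x) * ((character k x).im : ℂ)) * Complex.I_mul_I
    simp only [this]
    rw [integral_const_mul, integral_sub (hint _) (hint _), h1, h2]; simp
  · have : ∀ x : Torus n, character (-l) x * (wave true k x : ℂ) =
        (1 / 2) * (character (-l + k) x + character (-l + -k) x) := fun x => by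
      rw [character_add, character_add, character_neg k, wave, ← mul_add, Complex.add_conj]
      push_cast
      ring
    simp only [this]
    rw [integral_const_mul, integral_add (hint _) (hint _), h1, h2]; simp

theorem fieldCoeff_waveField (e : Bool) (k l : Fin n → ℤ) (c c' : Fin d) :
    fieldCoeff (waveField e k c) l c' = if c' = c then waveCoeff e k l else 0 := by
  have : ∫ x : Torus n, character (-l) x * ((waveField e k c x c' : ℝ) : ℂ) =
      ∫ x : Torus n, character (-l) x * (((if c' = c then wave e k x else 0 : ℝ)) : ℂ) := by
    refine integral_congr_ae ?_
    filter_upwards [coeFn_waveField e k c] with x hx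
    rw [hx]
    by_cases h : c' = c <;> simp [h]
  rw [fieldCoeff, this]
  by_cases h : c' = c <;> simp [h, waveCoeff]

/-- The field with `c`-th component `v_c cos (k · x)` or `v_c sin (k · x)`. -/
def polarizedWave (e : Bool) (k : Fin n → ℤ) (v : Fin d → ℝ) : L2Field n d :=
  ∑ c, v c • waveField e k c

theorem fieldCoeff_polarizedWave (e : Bool) (k l : Fin n → ℤ) (v : Fin d → ℝ) (c : Fin d) :
    fieldCoeff (polarizedWave e k v) l c = v c * waveCoeff e k l := by
  simp [polarizedWave, fieldCoeff_sum, fieldCoeff_smul, fieldCoeff_waveField]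

theorem isMeanZero_polarizedWave (e : Bool) {k : Fin n → ℤ} (hk : k ≠ 0) (v : Fin d → ℝ) :
    IsMeanZero (polarizedWave e k v) := fun c => by
  rw [fieldCoeff_polarizedWave, waveCoeff_eq_zero e hk.symm (by simpa [eq_comm] using hk), mul_zero]

theorem isSolenoidal_polarizedWave (e : Bool) {k : Fin n → ℤ} (hk : k ≠ 0) {v : Fin n → ℝ}
    (hv : ∑ c, (k c : ℝ) * v c = 0) : IsSolenoidal (polarizedWave e k v) := by
  refine ⟨isMeanZero_polarizedWave e hk v, fun l => ?_⟩
  simp only [fieldCoeff_polarizedWave, ← mul_assoc, ← Finset.sum_mul]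
  have hv' : ∑ c, (k c : ℂ) * (v c : ℂ) = 0 := by exact_mod_cast congrArg (fun x : ℝ => (x : ℂ)) hv
  by_cases h : l = k
  · rw [h, hv', zero_mul]
  by_cases h' : l = -k
  · simp only [h', Pi.neg_apply, Int.cast_neg, neg_mul, Finset.sum_neg_distrib, hv', neg_zero,
      zero_mul]
  · rw [waveCoeff_eq_zero e h h', mul_zero]

theorem fracSymbol_neg (s : ℝ) (k : Fin n → ℤ) : fracSymbol s (-k) = fracSymbol s k := by
  simp [fracSymbol]

/-- The symbol is even, so both frequencies `k` and `-k` carry the same eigenvalue. -/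
theorem isFracLaplacian_polarizedWave (s : ℝ) (e : Bool) (k : Fin n → ℤ) (v : Fin d → ℝ) :
    IsFracLaplacian s (polarizedWave e k v) (fracSymbol s k • polarizedWave e k v) := fun l c => by
  rw [fieldCoeff_smul, fieldCoeff_polarizedWave]
  by_cases h : l = k
  · rw [h]
  by_cases h' : l = -k
  · rw [h', fracSymbol_neg]
  · rw [waveCoeff_eq_zero e h h']; simp

theorem isSmoothField_polarizedWave (e : Bool) (k : Fin n → ℤ) (v : Fin d → ℝ) :
    IsSmoothField (polarizedWave e k v) := fun s => by
  refine ENNReal.rpow_lt_top_of_nonneg (by norm_num) (ENNReal.mul_ne_top (by simp) ?_)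
  rw [tsum_eq_sum (s := {k, -k}) fun l hl => ?_]
  · exact (ENNReal.sum_lt_top.2 fun l _ => ENNReal.mul_lt_top (by simp)
      (ENNReal.sum_lt_top.2 fun c _ => by simp [enorm_lt_top])).ne
  · simp only [Finset.mem_insert, Finset.mem_singleton, not_or] at hl
    simp [fieldCoeff_polarizedWave, waveCoeff_eq_zero e hl.1 hl.2]

theorem inner_polarizedWave (f : L2Field n d) (e : Bool) (k : Fin n → ℤ) (v : Fin d → ℝ) :
    inner ℝ f (polarizedWave e k v) = ∑ c, v c * inner ℝ f (waveField e k c) := by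
  simp [polarizedWave, inner_sum, real_inner_smul_right]

/-- The real and imaginary parts of the vanishing divergence coefficient at `k`. -/
theorem IsSolenoidal.sum_mul_inner_eq_zero {f : L2Field n n} (hf : IsSolenoidal f) (e : Bool)
    (k : Fin n → ℤ) : ∑ c, (k c : ℝ) * inner ℝ f (waveField e k c) = 0 := by
  have h := hf.2 k
  have h2 : ((2 * Real.pi : ℂ) ^ n)⁻¹ ≠ 0 := by simp [Real.pi_ne_zero]
  have h3 : ((2 * Real.pi : ℂ) ^ n)⁻¹ * (((∑ c, (k c : ℝ) * inner ℝ f (waveField true k c) : ℝ) : ℂ) -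
      ((∑ c, (k c : ℝ) * inner ℝ f (waveField false k c) : ℝ) : ℂ) * Complex.I) = 0 := by
    rw [← h]
    push_cast
    rw [Finset.sum_mul, ← Finset.sum_sub_distrib, Finset.mul_sum]
    refine Finset.sum_congr rfl fun c _ => ?_
    rw [fieldCoeff_eq_inner]; ring
  have h4 := (mul_eq_zero.1 h3).resolve_left h2
  cases e
  · simpa using congrArg Complex.im h4
  · simpa using congrArg Complex.re h4

/-- The spectral gap of the lattice: it makes the symbols monotone in the exponent away from
frequency zero. -/
theorem sum_sq_pos {k : Fin n → ℤ} (hk : k ≠ 0) : 1 ≤ ∑ i, (k i : ℝ) ^ 2 := by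
  obtain ⟨i, hi⟩ := Function.ne_iff.mp hk
  have h1 : (1 : ℝ) ≤ (k i : ℝ) ^ 2 := by
    have : (1 : ℤ) ≤ (k i) ^ 2 := by
      have := sq_pos_of_ne_zero hi
      omega
    exact_mod_cast this
  exact h1.trans (Finset.single_le_sum (f := fun i => (k i : ℝ) ^ 2) (fun _ _ => sq_nonneg _)
    (Finset.mem_univ i))

/-- For every frequency `k ≠ 0`, the space of the fields satisfying `V` contains plane waves that
recover the coefficients of its members. -/
structure IsWaveTested (V : L2Field n d → Prop) : Prop where
  exists_polarization : ∀ (e : Bool) (k : Fin n → ℤ) (c : Fin d), k ≠ 0 →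
    ∃ v : Fin d → ℝ, (∀ j, |v j| ≤ 2) ∧ V (polarizedWave e k v) ∧
      ∀ f, V f → inner ℝ f (polarizedWave e k v) = inner ℝ f (waveField e k c)

theorem isWaveTested_isMeanZero : IsWaveTested (IsMeanZero (n := n) (d := d)) where
  exists_polarization e k c hk := by
    refine ⟨Pi.single c 1, fun j => ?_, isMeanZero_polarizedWave e hk _, fun f _ => ?_⟩
    · by_cases h : j = c
      · subst h; simp
      · simp [h]
    · simp [inner_polarizedWave, Pi.single_apply]

theorem isWaveTested_isSolenoidal : IsWaveTested (IsSolenoidal (n := n)) where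
  exists_polarization e k c hk := by
    set N : ℝ := ∑ i, (k i : ℝ) ^ 2 with hN
    have hN1 : 1 ≤ N := sum_sq_pos hk
    have hN0 : N ≠ 0 := by positivity
    have hsq : ∀ j, (k j : ℝ) ^ 2 ≤ N := fun j =>
      Finset.single_le_sum (f := fun i => (k i : ℝ) ^ 2) (fun _ _ => sq_nonneg _)
        (Finset.mem_univ j)
    -- The Leray projection of `e_c` at frequency `k`. The subtracted multiple of `k` pairs to zero
    -- with solenoidal fields, and its entries are at most `1` in absolute value, whence the bound
    -- `2`.
    refine ⟨fun j => (if j = c then 1 else 0) - k c / N * k j, fun j => ?_,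
      isSolenoidal_polarizedWave e hk ?_, fun f hf => ?_⟩
    · have h1 : |(k c : ℝ) / N * k j| ≤ 1 := by
        rw [div_mul_eq_mul_div, abs_div, div_le_one (by positivity), abs_of_nonneg
          (by positivity : 0 ≤ N), abs_mul]
        nlinarith [hsq c, hsq j, sq_abs (k c : ℝ), sq_abs (k j : ℝ),
          sq_nonneg (|(k c : ℝ)| - |(k j : ℝ)|)]
      refine (abs_sub _ _).trans ?_
      have h2 : |(if j = c then (1 : ℝ) else 0)| ≤ 1 := by split_ifs <;> simp
      linarith
    · have h1 : ∀ j, (k j : ℝ) * ((if j = c then 1 else 0) - k c / N * k j) =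
          (if j = c then (k j : ℝ) else 0) - k c / N * (k j : ℝ) ^ 2 := fun j => by
        split_ifs <;> ring
      simp only [h1]
      rw [Finset.sum_sub_distrib, ← Finset.mul_sum, ← hN, Finset.sum_ite_eq']
      simp [hN0]
    · have h0 := hf.sum_mul_inner_eq_zero e k
      rw [inner_polarizedWave]
      have h1 : ∀ j, ((if j = c then (1 : ℝ) else 0) - k c / N * k j) *
          inner ℝ f (waveField e k j) = (if j = c then inner ℝ f (waveField e k j) else 0) -
            k c / N * ((k j : ℝ) * inner ℝ f (waveField e k j)) := fun j => by
        split_ifs <;> ring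
      simp only [h1]
      rw [Finset.sum_sub_distrib, ← Finset.mul_sum, h0, Finset.sum_ite_eq']
      simp
end

noncomputable section

/-! ### Sobolev norms and traces as weighted sums over the trigonometric fields -/

variable {n d : ℕ}

/-- The sum of the `Y i` with weights `|k|^{2 s}`, over the frequencies `k`, the components and the
two phases. -/
def waveSum (s : ℝ) (Y : (Fin n → ℤ) × Fin d × Bool → ℝ≥0∞) : ℝ≥0∞ :=
  ∑' i, ENNReal.ofReal (fracSymbol s i.1) * Y i

/-- The coefficient of a field against a trigonometric field. -/
def waveInner (f : L2Field n d) (i : (Fin n → ℤ) × Fin d × Bool) : ℝ :=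
  inner ℝ f (waveField i.2.2 i.1 i.2.1)

theorem fracSymbol_nonneg (s : ℝ) (k : Fin n → ℤ) : 0 ≤ fracSymbol s k :=
  Real.rpow_nonneg (Finset.sum_nonneg fun _ _ => sq_nonneg _) _

theorem fracSymbol_pos (s : ℝ) {k : Fin n → ℤ} (hk : k ≠ 0) : 0 < fracSymbol s k :=
  Real.rpow_pos_of_pos (zero_lt_one.trans_le (sum_sq_pos hk)) _

/-- Since `0 ^ 0 = 1` for `Real.rpow`, the condition `s ≠ 0` is what discards frequency zero, where
no equation is tested, from the norms. -/
theorem fracSymbol_zero {s : ℝ} (hs : s ≠ 0) : fracSymbol s (0 : Fin n → ℤ) = 0 := by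
  simp [fracSymbol, Real.zero_rpow hs]

theorem waveSum_eq (s : ℝ) (Y : (Fin n → ℤ) × Fin d × Bool → ℝ≥0∞) :
    waveSum s Y = ∑' k : Fin n → ℤ, ENNReal.ofReal (fracSymbol s k) *
      ∑ c, (Y (k, c, true) + Y (k, c, false)) := by
  rw [waveSum, ENNReal.tsum_prod']
  refine tsum_congr fun k => ?_
  rw [tsum_fintype, Fintype.sum_prod_type]
  simp only [Fintype.sum_bool, ← mul_add, Finset.mul_sum]

theorem hdotNorm_eq_waveSum (s : ℝ) (f : L2Field n d) :
    hdotNorm s f = (ENNReal.ofReal (((2 * Real.pi) ^ n)⁻¹) *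
      waveSum s fun i => ENNReal.ofReal (waveInner f i ^ 2)) ^ (1 / 2 : ℝ) := by
  have hpos : (0 : ℝ) < (2 * Real.pi) ^ n := by positivity
  rw [hdotNorm, waveSum_eq]
  congr 1
  rw [← ENNReal.tsum_mul_left, ← ENNReal.tsum_mul_left]
  refine tsum_congr fun k => ?_
  rw [mul_left_comm, mul_left_comm (ENNReal.ofReal (((2 * Real.pi) ^ n)⁻¹))]
  congr 1
  rw [Finset.mul_sum, Finset.mul_sum]
  refine Finset.sum_congr rfl fun c _ => ?_
  rw [enorm_fieldCoeff_sq, ← ENNReal.ofReal_mul hpos.le, ← ENNReal.ofReal_add (sq_nonneg _)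
    (sq_nonneg _), ← ENNReal.ofReal_mul (by positivity)]
  congr 1
  simp only [waveInner]
  field_simp

theorem traceFracLaplacian_eq_waveSum (s : ℝ) {Q : L2Field n d →L[ℝ] L2Field n d}
    (hQ : ∀ φ, 0 ≤ inner ℝ (Q φ) φ) :
    traceFracLaplacian s Q = ENNReal.ofReal (((2 * Real.pi) ^ n)⁻¹) *
      waveSum s fun i => ENNReal.ofReal
        (inner ℝ (Q (waveField i.2.2 i.1 i.2.1)) (waveField i.2.2 i.1 i.2.1)) := by
  rw [traceFracLaplacian, waveSum_eq, ← ENNReal.tsum_mul_left]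
  refine tsum_congr fun k => ?_
  rw [mul_left_comm, Finset.mul_sum, Finset.mul_sum]
  refine Finset.sum_congr rfl fun c _ => ?_
  rw [ENNReal.ofReal_mul (fracSymbol_nonneg s k), ENNReal.ofReal_mul (by positivity),
    ← ENNReal.ofReal_add (hQ _) (hQ _)]
  rfl

theorem waveSum_le {s s₀ : ℝ} (hs : s ≠ 0) {Y Y₀ : (Fin n → ℤ) × Fin d × Bool → ℝ≥0∞} {M : ℝ≥0∞}
    (h : ∀ i, i.1 ≠ 0 → ENNReal.ofReal (fracSymbol s i.1) * Y i ≤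
      M * (ENNReal.ofReal (fracSymbol s₀ i.1) * Y₀ i)) :
    waveSum s Y ≤ M * waveSum s₀ Y₀ := by
  rw [waveSum, waveSum, ← ENNReal.tsum_mul_left]
  refine ENNReal.tsum_le_tsum fun i => ?_
  by_cases hi : i.1 = 0
  · simp [hi, fracSymbol_zero hs]
  · exact h i hi

theorem fracSymbol_le_of_le {s s' : ℝ} (h : s ≤ s') {k : Fin n → ℤ} (hk : k ≠ 0) :
    fracSymbol s k ≤ fracSymbol s' k :=
  Real.rpow_le_rpow_of_exponent_le (sum_sq_pos hk) h

theorem hdotNorm_mono {s s' : ℝ} (hs : s ≠ 0) (h : s ≤ s') (f : L2Field n d) :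
    hdotNorm s f ≤ hdotNorm s' f := by
  rw [hdotNorm_eq_waveSum, hdotNorm_eq_waveSum]
  gcongr
  refine (waveSum_le (M := 1) hs fun i hi => ?_).trans_eq (one_mul _)
  rw [one_mul]
  gcongr
  exact fracSymbol_le_of_le h hi

theorem waveInner_sub (f g : L2Field n d) (i : (Fin n → ℤ) × Fin d × Bool) :
    waveInner (f - g) i = waveInner f i - waveInner g i := inner_sub_left _ _ _

/-- A field is bounded in `Ḣ^s` when its coefficients are dominated. -/
theorem hdotNorm_le {s s₀ : ℝ} (hs : s ≠ 0) {f : L2Field n d}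
    {Y : (Fin n → ℤ) × Fin d × Bool → ℝ≥0∞} {M : ℝ≥0∞}
    (h : ∀ i, i.1 ≠ 0 → ENNReal.ofReal (fracSymbol s i.1) * ENNReal.ofReal (waveInner f i ^ 2) ≤
      M * (ENNReal.ofReal (fracSymbol s₀ i.1) * Y i)) :
    hdotNorm s f ≤ (ENNReal.ofReal (((2 * Real.pi) ^ n)⁻¹) * (M * waveSum s₀ Y)) ^ (1 / 2 : ℝ) := by
  rw [hdotNorm_eq_waveSum]
  gcongr
  exact waveSum_le hs h

/-- Dominated convergence for the counting measure on the modes. -/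
theorem tendsto_hdotNorm_zero {α : Type*} {l : Filter α} [l.IsCountablyGenerated] {s s₀ : ℝ}
    (hs : s ≠ 0) {g : α → L2Field n d} {Y : (Fin n → ℤ) × Fin d × Bool → ℝ≥0∞} {M : ℝ≥0∞}
    (hM : M ≠ ∞) (hY : waveSum s₀ Y ≠ ∞)
    (hlim : ∀ i, i.1 ≠ 0 → Tendsto (fun r => waveInner (g r) i) l (𝓝 0))
    (h : ∀ᶠ r in l, ∀ i, i.1 ≠ 0 →
      ENNReal.ofReal (fracSymbol s i.1) * ENNReal.ofReal (waveInner (g r) i ^ 2) ≤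
      M * (ENNReal.ofReal (fracSymbol s₀ i.1) * Y i)) :
    Tendsto (fun r => hdotNorm s (g r)) l (𝓝 0) := by
  have key : Tendsto (fun r => waveSum s fun i => ENNReal.ofReal (waveInner (g r) i ^ 2)) l
      (𝓝 0) := by
    simp only [waveSum, ← lintegral_count]
    rw [← lintegral_zero (μ := Measure.count (α := (Fin n → ℤ) × Fin d × Bool))]
    refine tendsto_lintegral_filter_of_dominated_convergence
      (fun i => M * (ENNReal.ofReal (fracSymbol s₀ i.1) * Y i))
      (Eventually.of_forall fun r => measurable_of_countable _) ?_ ?_ ?_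
    · filter_upwards [h] with r hr
      refine Eventually.of_forall fun i => ?_
      by_cases hi : i.1 = 0
      · simp [hi, fracSymbol_zero hs]
      · exact hr i hi
    · rw [lintegral_count, ENNReal.tsum_mul_left]
      exact ENNReal.mul_ne_top hM hY
    · refine Eventually.of_forall fun i => ?_
      by_cases hi : i.1 = 0
      · simpa [hi, fracSymbol_zero hs] using tendsto_const_nhds
      · have h1 := ENNReal.tendsto_ofReal ((hlim i hi).pow 2)
        have h2 := ENNReal.Tendsto.const_mul (a := ENNReal.ofReal (fracSymbol s i.1)) h1
          (Or.inr ENNReal.ofReal_ne_top)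
        simpa using h2
  simp only [hdotNorm_eq_waveSum]
  have h1 := ENNReal.Tendsto.const_mul (a := ENNReal.ofReal (((2 * Real.pi) ^ n)⁻¹)) key
    (Or.inr ENNReal.ofReal_ne_top)
  have h2 := (ENNReal.continuous_rpow_const (y := (1 / 2 : ℝ))).tendsto _ |>.comp h1
  simpa [Function.comp_def] using h2

/-- A series of nonnegative continuous terms is lower semicontinuous. Only continuity of each mode
is needed, not continuity in the Sobolev norm. -/
theorem lowerSemicontinuous_hdotNorm {α : Type*} [TopologicalSpace α] {s : ℝ} (hs : s ≠ 0)
    {g : α → L2Field n d} (hg : ∀ i, i.1 ≠ 0 → Continuous fun x => waveInner (g x) i) :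
    LowerSemicontinuous fun x => hdotNorm s (g x) := by
  have h1 : LowerSemicontinuous fun x =>
      waveSum s fun i => ENNReal.ofReal (waveInner (g x) i ^ 2) := by
    refine lowerSemicontinuous_tsum fun i => Continuous.lowerSemicontinuous ?_
    by_cases hi : i.1 = 0
    · simpa [hi, fracSymbol_zero hs] using continuous_const
    · exact (ENNReal.continuous_const_mul ENNReal.ofReal_ne_top).comp
        (ENNReal.continuous_ofReal.comp ((hg i hi).pow 2))
  simp only [hdotNorm_eq_waveSum]
  refine Continuous.comp_lowerSemicontinuous (g := fun y : ℝ≥0∞ =>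
    (ENNReal.ofReal (((2 * Real.pi) ^ n)⁻¹) * y) ^ (1 / 2 : ℝ)) ?_ h1 ?_
  · exact ENNReal.continuous_rpow_const.comp (ENNReal.continuous_const_mul ENNReal.ofReal_ne_top)
  · intro x y hxy
    simp only
    gcongr

/-! ### Two facts on `ℝ≥0∞`-valued random variables -/

/-- Superlevel sets are open, so a nonempty one meets a countable dense set, and the supremum is
attained along that set. -/
theorem aemeasurable_iSup_of_lowerSemicontinuous {Ω S : Type*} [MeasurableSpace Ω] {P : Measure Ω}
    [TopologicalSpace S] [SecondCountableTopology S] {g : S → Ω → ℝ≥0∞}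
    (hm : ∀ x, AEMeasurable (g x) P)
    (hg : ∀ᵐ ω ∂P, LowerSemicontinuous fun x => g x ω) :
    AEMeasurable (fun ω => ⨆ x, g x ω) P := by
  obtain ⟨D, hDc, hD⟩ := TopologicalSpace.exists_countable_dense S
  have := hDc.to_subtype
  refine (AEMeasurable.iSup fun x : D => hm x).congr ?_
  filter_upwards [hg] with ω hω
  refine le_antisymm (iSup_le fun x => le_iSup (fun x => g x ω) x.1) ?_
  refine iSup_le fun x => le_of_forall_lt fun y hy => ?_
  obtain ⟨x', hxD, hx'⟩ := hD.exists_mem_open (hω.isOpen_preimage y) ⟨x, hy⟩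
  exact lt_of_lt_of_le hx' (le_iSup (fun x : D => g x ω) ⟨x', hxD⟩)

theorem lintegral_finset_sum_rpow_le {Ω ι : Type*} [MeasurableSpace Ω] {P : Measure Ω}
    {f : ι → Ω → ℝ≥0∞} (hf : ∀ i, AEMeasurable (f i) P) {p : ℝ} (hp : 1 ≤ p) (F : Finset ι) :
    (∫⁻ ω, (∑ i ∈ F, f i ω) ^ p ∂P) ^ (1 / p) ≤ ∑ i ∈ F, (∫⁻ ω, f i ω ^ p ∂P) ^ (1 / p) := by
  classical
  have hp0 : 0 < p := by linarith
  induction F using Finset.induction_on with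
  | empty => simp [hp0]
  | insert i F hi ih =>
    simp only [Finset.sum_insert hi]
    exact (ENNReal.lintegral_Lp_add_le (hf i) (Finset.aemeasurable_fun_sum _ fun j _ => hf j)
      hp).trans (add_le_add le_rfl ih)

/-- Minkowski's inequality for countable sums. -/
theorem lintegral_tsum_rpow_le {Ω ι : Type*} [Countable ι] [MeasurableSpace Ω] {P : Measure Ω}
    {f : ι → Ω → ℝ≥0∞} (hf : ∀ i, AEMeasurable (f i) P) {p : ℝ} (hp : 1 ≤ p) :
    (∫⁻ ω, (∑' i, f i ω) ^ p ∂P) ^ (1 / p) ≤ ∑' i, (∫⁻ ω, f i ω ^ p ∂P) ^ (1 / p) := by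
  have hp0 : 0 < p := by linarith
  have h1 : ∀ ω, (∑' i, f i ω) ^ p = ⨆ F : Finset ι, (∑ i ∈ F, f i ω) ^ p := fun ω => by
    rw [ENNReal.tsum_eq_iSup_sum]
    exact (ENNReal.orderIsoRpow p hp0).map_iSup _
  simp only [h1]
  rw [lintegral_iSup_directed (fun F => (Finset.aemeasurable_fun_sum _ fun j _ => hf j).pow_const _)]
  · rw [one_div, ENNReal.rpow_inv_le_iff hp0, ← one_div]
    refine iSup_le fun F => ?_
    rw [← ENNReal.rpow_inv_le_iff hp0, ← one_div]
    exact (lintegral_finset_sum_rpow_le hf hp F).trans (ENNReal.sum_le_tsum F)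
  · refine Monotone.directed_le fun F F' h ω => ?_
    exact ENNReal.rpow_le_rpow (Finset.sum_le_sum_of_subset h) hp0.le
end

noncomputable section

/-! ### Ornstein–Uhlenbeck paths driven by a path with finite `dyadicSum` -/

/-- The path `ouPath` at the time `t ≥ 0`, for a driving path on the half-line. -/
def ouProcess (a : ℝ) (β : ℝ≥0 → ℝ) (t : ℝ≥0) : ℝ := ouPath a (fun u => β u.toNNReal) t

theorem continuous_ouProcess {a : ℝ} {β : ℝ≥0 → ℝ} (hβ : Continuous β) :
    Continuous (ouProcess a β) :=
  (continuous_ouPath (by fun_prop)).comp NNReal.continuous_coe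

section Bounds

variable {a γ : ℝ} {β : ℝ≥0 → ℝ} {T : ℝ≥0} {p : ℕ}

/-- The path is extended to negative times by its initial value; the positive part is `1`-Lipschitz,
so the Hölder bound survives. -/
theorem abs_toNNReal_sub_le_dyadicSum (hβ : Continuous β) (hγ : 0 < γ) (hT : 0 < T) (hp : p ≠ 0)
    (hS : dyadicSum T γ p β ≠ ∞) {s t : ℝ} (hs : s ≤ T) (ht : t ≤ T) :
    |β t.toNNReal - β s.toNNReal| ≤
      chainConst T γ * (dyadicSum T γ p β).toReal ^ ((2 * p : ℕ) : ℝ)⁻¹ * |t - s| ^ γ := by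
  have hC := (chainConst_pos (T := T) (γ := γ) hT hγ).le
  refine (abs_sub_le_dyadicSum hβ hγ hT hp hS (Real.toNNReal_le_iff_le_coe.2 hs)
    (Real.toNNReal_le_iff_le_coe.2 ht)).trans ?_
  refine mul_le_mul_of_nonneg_left (Real.rpow_le_rpow (abs_nonneg _) ?_ hγ.le) (by positivity)
  rw [Real.coe_toNNReal', Real.coe_toNNReal']
  exact abs_max_sub_max_le_abs t s 0

theorem ofReal_sq_le_dyadicSum (hS : dyadicSum T γ p β ≠ ∞) (hp : p ≠ 0) {x C : ℝ}
    (h : |x| ≤ C * (dyadicSum T γ p β).toReal ^ ((2 * p : ℕ) : ℝ)⁻¹) :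
    ENNReal.ofReal (x ^ 2) ≤ ENNReal.ofReal (C ^ 2) * dyadicSum T γ p β ^ (p : ℝ)⁻¹ := by
  set S := dyadicSum T γ p β
  have h1 : x ^ 2 ≤ C ^ 2 * S.toReal ^ (p : ℝ)⁻¹ := by
    rw [← sq_abs x]
    refine (pow_le_pow_left₀ (abs_nonneg x) h 2).trans_eq ?_
    rw [mul_pow, ← Real.rpow_natCast (S.toReal ^ _), ← Real.rpow_mul ENNReal.toReal_nonneg]
    congr 2
    push_cast
    field_simp
  refine (ENNReal.ofReal_le_ofReal h1).trans_eq ?_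
  rw [ENNReal.ofReal_mul (sq_nonneg _), ← ENNReal.ofReal_rpow_of_nonneg ENNReal.toReal_nonneg
    (by positivity), ENNReal.ofReal_toReal hS]

theorem ofReal_ouProcess_sq_le (ha : 0 < a) (hβ : Continuous β) (hβ0 : β 0 = 0) (hγ : 0 < γ)
    (hγ1 : γ ≤ 1) (hT : 0 < T) (hp : p ≠ 0) (hS : dyadicSum T γ p β ≠ ∞) {t : ℝ≥0} (ht : t ≤ T) :
    ENNReal.ofReal (ouProcess a β t ^ 2) ≤
      ENNReal.ofReal ((6 * chainConst T γ) ^ 2 * a ^ (-(2 * γ))) *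
        dyadicSum T γ p β ^ (p : ℝ)⁻¹ := by
  have hC := (chainConst_pos (T := T) (γ := γ) hT hγ).le
  have h := abs_ouPath_le (T := T) ha hγ.le hγ1
    (by positivity : 0 ≤ chainConst T γ * (dyadicSum T γ p β).toReal ^ ((2 * p : ℕ) : ℝ)⁻¹)
    (b := fun u => β u.toNNReal) (by fun_prop) (by simpa using hβ0)
    (fun s t hs ht => abs_toNNReal_sub_le_dyadicSum hβ hγ hT hp hS hs ht) t.coe_nonneg ht
  have h2 := ofReal_sq_le_dyadicSum hS hp (x := ouProcess a β t)
    (C := 6 * chainConst T γ * a ^ (-γ)) (h.trans_eq (by ring))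
  refine h2.trans_eq ?_
  rw [mul_pow _ (a ^ (-γ)), ← Real.rpow_natCast (a ^ (-γ)), ← Real.rpow_mul ha.le]
  congr 4
  push_cast; ring

theorem ofReal_ouProcess_sub_sq_le (ha : 0 < a) (hβ : Continuous β) (hβ0 : β 0 = 0) (hγ : 0 < γ)
    (hT : 0 < T) (hp : p ≠ 0) (hS : dyadicSum T γ p β ≠ ∞) {s t : ℝ≥0} (hs : s ≤ T) (ht : t ≤ T) :
    ENNReal.ofReal ((ouProcess a β t - ouProcess a β s) ^ 2) ≤
      ENNReal.ofReal ((2 * chainConst T γ * dist t s ^ γ) ^ 2) *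
        dyadicSum T γ p β ^ (p : ℝ)⁻¹ := by
  wlog hst : s ≤ t generalizing s t
  · rw [dist_comm, ← neg_sub, neg_sq]
    exact this ht hs (le_of_not_ge hst)
  have hC := (chainConst_pos (T := T) (γ := γ) hT hγ).le
  have h := abs_ouPath_sub_le (T := T) (γ := γ) ha
    (by positivity : 0 ≤ chainConst T γ * (dyadicSum T γ p β).toReal ^ ((2 * p : ℕ) : ℝ)⁻¹)
    (b := fun u => β u.toNNReal) (by fun_prop)
    (fun t ht => by simpa [Real.toNNReal_of_nonpos ht] using hβ0)
    (fun s t hs ht => abs_toNNReal_sub_le_dyadicSum hβ hγ hT hp hS hs ht) s.coe_nonneg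
    (NNReal.coe_le_coe.2 hst) ht
  refine ofReal_sq_le_dyadicSum hS hp (h.trans_eq ?_)
  rw [NNReal.dist_eq]; ring

end Bounds

/-! ### Measurability of the Ornstein–Uhlenbeck process -/

/-- The convolution needs joint measurability in time and `ω`. Outside a measurable null set the
path is continuous and agrees with measurable versions at a countable dense set of times; setting it
to zero on that null set gives measurability at every time by limits. -/
theorem exists_continuous_modification {Ω : Type*} [MeasurableSpace Ω] {P : Measure Ω}
    {β : ℝ≥0 → Ω → ℝ} (hm : ∀ t, AEMeasurable (β t) P)
    (hc : ∀ᵐ ω ∂P, Continuous fun t => β t ω) :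
    ∃ β' : ℝ≥0 → Ω → ℝ, (∀ t, Measurable (β' t)) ∧ (∀ ω, Continuous fun t => β' t ω) ∧
      ∀ᵐ ω ∂P, ∀ t, β t ω = β' t ω := by
  obtain ⟨D, hDc, hD⟩ := TopologicalSpace.exists_countable_dense ℝ≥0
  have := hDc.to_subtype
  have hgood : ∀ᵐ ω ∂P, (Continuous fun t => β t ω) ∧ ∀ q : D, β q ω = (hm q).mk _ ω := by
    filter_upwards [hc, ae_all_iff.2 fun q : D => (hm q).ae_eq_mk] with ω h1 h2 using ⟨h1, h2⟩
  obtain ⟨N, hNsub, hNm, hN0⟩ := exists_measurable_superset_of_null (ae_iff.1 hgood)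
  have hN : ∀ ω, ω ∉ N → (Continuous fun t => β t ω) ∧ ∀ q : D, β q ω = (hm q).mk _ ω :=
    fun ω hω => by
      by_contra h
      exact hω (hNsub h)
  have hcont : ∀ ω, Continuous fun t => Nᶜ.indicator (β t) ω := fun ω => by
    by_cases hω : ω ∈ N
    · simpa [hω] using continuous_const
    · simpa [hω] using (hN ω hω).1
  have hDmeas : ∀ q : D, Measurable (Nᶜ.indicator (β q)) := fun q => by
    have : Nᶜ.indicator (β q) = Nᶜ.indicator ((hm q).mk _) := by
      refine Set.indicator_congr fun ω hω => (hN ω hω).2 q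
    rw [this]
    exact (hm q).measurable_mk.indicator hNm.compl
  refine ⟨fun t => Nᶜ.indicator (β t), fun t => ?_, hcont, ?_⟩
  · obtain ⟨u, huD, hu⟩ := mem_closure_iff_seq_limit.1 (hD t)
    refine measurable_of_tendsto_metrizable (fun j => hDmeas ⟨u j, huD j⟩) ?_
    rw [tendsto_pi_nhds]
    exact fun ω => ((hcont ω).tendsto t).comp hu
  · have : ∀ᵐ ω ∂P, ω ∉ N := measure_eq_zero_iff_ae_notMem.1 hN0
    filter_upwards [this] with ω hω t
    simp [hω]

theorem aemeasurable_ouProcess {Ω : Type*} [MeasurableSpace Ω] {P : Measure Ω}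
    {β : ℝ≥0 → Ω → ℝ} (hm : ∀ t, AEMeasurable (β t) P)
    (hc : ∀ᵐ ω ∂P, Continuous fun t => β t ω) (a : ℝ) (t : ℝ≥0) :
    AEMeasurable (fun ω => ouProcess a (fun s => β s ω) t) P := by
  obtain ⟨β', hm', hc', hββ'⟩ := exists_continuous_modification hm hc
  have hu : Measurable (Function.uncurry β') := measurable_uncurry_of_continuous_of_measurable hc' hm'
  have h1 : Measurable fun ω => ouProcess a (fun s => β' s ω) t := by
    simp only [ouProcess, ouPath, intervalIntegral.integral_of_le t.coe_nonneg]
    refine (hm' _).sub (Measurable.const_mul ?_ _)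
    have h2 : StronglyMeasurable (Function.uncurry fun (ω : Ω) (r : ℝ) =>
        Real.exp (-(a * r)) * β' ((t : ℝ) - r).toNNReal ω) := by
      refine Measurable.stronglyMeasurable ?_
      have h3 : Measurable fun x : Ω × ℝ => Function.uncurry β' (((t : ℝ) - x.2).toNNReal, x.1) :=
        hu.comp (by fun_prop)
      exact (by fun_prop : Measurable fun x : Ω × ℝ => Real.exp (-(a * x.2))).mul h3
    exact h2.integral_prod_right.measurable
  refine h1.aemeasurable.congr ?_
  filter_upwards [hββ'] with ω hω
  simp only [hω]
end

noncomputable section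

/-! ### The driving Brownian motions -/

section Covariance

variable {U : Type*} [NormedAddCommGroup U] [InnerProductSpace ℝ U] [CompleteSpace U] {n d : ℕ}

theorem inner_covOp (G : U →L[ℝ] L2Field n d) (φ : L2Field n d) :
    inner ℝ (covOp G φ) φ = ‖ContinuousLinearMap.adjoint G φ‖ ^ 2 := by
  rw [covOp, ContinuousLinearMap.comp_apply, ← ContinuousLinearMap.adjoint_inner_right,
    real_inner_self_eq_norm_sq]

/-- Triangle inequality for `G*` and Cauchy–Schwarz, with `4 = 2 ^ 2` from the entries of `v`. Thus
the variance seen by a projected wave is controlled by the terms of the trace at the same frequency.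
-/
theorem inner_covOp_polarizedWave_le (G : U →L[ℝ] L2Field n d) (e : Bool) (k : Fin n → ℤ)
    {v : Fin d → ℝ} (hv : ∀ j, |v j| ≤ 2) :
    inner ℝ (covOp G (polarizedWave e k v)) (polarizedWave e k v) ≤
      4 * d * ∑ j, inner ℝ (covOp G (waveField e k j)) (waveField e k j) := by
  simp only [inner_covOp]
  set A := ContinuousLinearMap.adjoint G
  have h1 : ‖A (polarizedWave e k v)‖ ≤ ∑ j, 2 * ‖A (waveField e k j)‖ := by
    rw [polarizedWave, map_sum]
    refine (norm_sum_le _ _).trans (Finset.sum_le_sum fun j _ => ?_)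
    rw [map_smul, norm_smul, Real.norm_eq_abs]
    exact mul_le_mul_of_nonneg_right (hv j) (norm_nonneg _)
  calc ‖A (polarizedWave e k v)‖ ^ 2 ≤ (∑ j, 2 * ‖A (waveField e k j)‖) ^ 2 := by gcongr
    _ ≤ (d : ℝ) * ∑ j, (2 * ‖A (waveField e k j)‖) ^ 2 := by
        simpa using sq_sum_le_card_mul_sum_sq (s := Finset.univ)
          (f := fun j => 2 * ‖A (waveField e k j)‖)
    _ = 4 * d * ∑ j, ‖A (waveField e k j)‖ ^ 2 := by
        simp only [mul_pow, ← Finset.mul_sum]; ring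

/-- The variance of the coefficient `i` of the noise, up to a factor. -/
def waveVariance (G : U →L[ℝ] L2Field n d) (i : (Fin n → ℤ) × Fin d × Bool) : ℝ :=
  4 * d * ∑ j, inner ℝ (covOp G (waveField i.2.2 i.1 j)) (waveField i.2.2 i.1 j)

/-- `waveVariance` does not depend on the component, so summing it over components only multiplies
the trace series by constants. -/
theorem waveSum_waveVariance_lt_top {G : U →L[ℝ] L2Field n d} {s : ℝ}
    (hG : traceFracLaplacian s (covOp G) < ∞) :
    waveSum s (fun i => ENNReal.ofReal (waveVariance G i)) < ∞ := by
  have hnn : ∀ φ, 0 ≤ inner ℝ (covOp G φ) φ := fun φ => by rw [inner_covOp]; positivity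
  rw [traceFracLaplacian_eq_waveSum s hnn, waveSum_eq] at hG
  have h2 : ∑' k : Fin n → ℤ, ENNReal.ofReal (fracSymbol s k) *
      ∑ c : Fin d, (ENNReal.ofReal (inner ℝ (covOp G (waveField true k c)) (waveField true k c)) +
        ENNReal.ofReal (inner ℝ (covOp G (waveField false k c)) (waveField false k c))) < ∞ := by
    refine ENNReal.lt_top_of_mul_ne_top_right hG.ne ?_
    simp only [ne_eq, ENNReal.ofReal_eq_zero, not_le]
    positivity
  have h3 : waveSum s (fun i => ENNReal.ofReal (waveVariance G i)) =
      ENNReal.ofReal (4 * d) * d * ∑' k : Fin n → ℤ, ENNReal.ofReal (fracSymbol s k) *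
      ∑ c : Fin d, (ENNReal.ofReal (inner ℝ (covOp G (waveField true k c)) (waveField true k c)) +
        ENNReal.ofReal (inner ℝ (covOp G (waveField false k c)) (waveField false k c))) := by
    rw [waveSum_eq, ← ENNReal.tsum_mul_left]
    refine tsum_congr fun k => ?_
    rw [mul_left_comm]
    congr 1
    simp only [waveVariance]
    have h4 : (0 : ℝ) ≤ 4 * d := by positivity
    rw [Finset.sum_const, Finset.card_univ, Fintype.card_fin, nsmul_eq_mul,
      ENNReal.ofReal_mul h4, ENNReal.ofReal_mul h4,
      ENNReal.ofReal_sum_of_nonneg fun _ _ => hnn _, ENNReal.ofReal_sum_of_nonneg fun _ _ => hnn _,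
      ← mul_add, ← Finset.sum_add_distrib]
    ring
  rw [h3]
  exact ENNReal.mul_lt_top (ENNReal.mul_lt_top ENNReal.ofReal_lt_top (by simp)) h2

end Covariance

variable {Ω : Type*} [MeasurableSpace Ω] {P : Measure Ω} {n d : ℕ}

/-- A family `β` of Brownian motions with variances `q` drives the coefficients of `z`. -/
structure IsDriver (P : Measure Ω) (lam : ℝ) (z : ℝ≥0 → Ω → L2Field n d)
    (q : (Fin n → ℤ) × Fin d × Bool → ℝ) (β : (Fin n → ℤ) × Fin d × Bool → ℝ≥0 → Ω → ℝ) : Prop where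
  aemeasurable : ∀ i t, AEMeasurable (β i t) P
  zero : ∀ᵐ ω ∂P, ∀ i, β i 0 ω = 0
  continuous : ∀ᵐ ω ∂P, ∀ i, Continuous fun t => β i t ω
  gaussian : ∀ i, ∃ v : ℝ≥0, (v : ℝ≥0∞) ≤ ENNReal.ofReal (q i) ∧ ∀ s t : ℝ≥0, s ≤ t →
    P.map (fun ω => β i t ω - β i s ω) = gaussianReal 0 ((t - s) * v)
  waveInner_eq : ∀ᵐ ω ∂P, ∀ i, i.1 ≠ 0 → ∀ t,
    waveInner (z t ω) i = ouProcess (fracSymbol lam i.1) (fun s => β i s ω) t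

variable {U : Type*} [NormedAddCommGroup U] [InnerProductSpace ℝ U] [CompleteSpace U]

/-- The test wave is an eigenfield of `(-Δ)^lam`, so the weak formulation closes into the scalar
equation for one coefficient. -/
theorem IsWeakSolution.waveInner_eq_ouProcess {V : L2Field n d → Prop} {lam : ℝ}
    {B z : ℝ≥0 → Ω → L2Field n d} (hz : IsWeakSolution P V lam B z)
    (hBc : ∀ᵐ ω ∂P, Continuous fun t => B t ω) {i : (Fin n → ℤ) × Fin d × Bool}
    (hi : i.1 ≠ 0) {v : Fin d → ℝ} (hv : V (polarizedWave i.2.2 i.1 v))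
    (hf : ∀ f, V f → inner ℝ f (polarizedWave i.2.2 i.1 v) = waveInner f i) :
    ∀ᵐ ω ∂P, ∀ t, waveInner (z t ω) i = ouProcess (fracSymbol lam i.1)
      (fun s => inner ℝ (B s ω) (polarizedWave i.2.2 i.1 v)) t := by
  set φ := polarizedWave (d := d) i.2.2 i.1 v with hφ
  set a := fracSymbol lam i.1 with ha
  obtain ⟨hzV, hz0, hzw⟩ := hz
  filter_upwards [hzV, hz0, hBc, hzw φ (a • φ) hv (isSmoothField_polarizedWave _ _ _)
    (isFracLaplacian_polarizedWave _ _ _ _)] with ω hmem hinit hc hweak t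
  have hb : Continuous fun u : ℝ => inner ℝ (B u.toNNReal ω) φ := by fun_prop
  have key := eq_ouPath (a := a) (b := fun u : ℝ => inner ℝ (B u.toNNReal ω) φ)
    (X := fun u : ℝ => inner ℝ (z u.toNNReal ω) φ) hb ?_ t.coe_nonneg
  · rw [← hf _ (hmem t)]
    simpa [ouProcess] using key
  intro u hu
  have ha0 : a ≠ 0 := (fracSymbol_pos lam hi).ne'
  obtain ⟨h1, h2⟩ := hweak u.toNNReal
  rw [Real.coe_toNNReal u hu] at h1 h2
  simp only [real_inner_smul_right] at h1 h2
  rw [intervalIntegral.integral_const_mul, hinit, inner_zero_left, sub_zero] at h2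
  refine ⟨?_, h2⟩
  -- The weak formulation gives integrability of `a X`; dividing by `a ≠ 0` gives that of `X`.
  have := h1.const_mul a⁻¹
  simpa [ha0] using this

theorem IsWeakSolution.exists_isDriver {V : L2Field n d → Prop} (hV : IsWaveTested V) {lam : ℝ}
    {G : U →L[ℝ] L2Field n d} {B z : ℝ≥0 → Ω → L2Field n d}
    (hB : IsWienerProcess P (covOp G) B) (hz : IsWeakSolution P V lam B z) :
    ∃ β, IsDriver P lam z (waveVariance G) β := by
  have hex : ∀ i : (Fin n → ℤ) × Fin d × Bool, ∃ v : Fin d → ℝ, (∀ j, |v j| ≤ 2) ∧ (i.1 ≠ 0 →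
      V (polarizedWave i.2.2 i.1 v) ∧
        ∀ f, V f → inner ℝ f (polarizedWave i.2.2 i.1 v) = waveInner f i) := fun i => by
    by_cases hi : i.1 = 0
    -- A dummy polarization: the driver at frequency zero is identically zero and never used.
    · exact ⟨0, by simp, fun h => absurd hi h⟩
    · obtain ⟨v, h1, h2, h3⟩ := hV.exists_polarization i.2.2 i.1 i.2.1 hi
      exact ⟨v, h1, fun _ => ⟨h2, h3⟩⟩
  choose v hv2 hv using hex
  refine ⟨fun i t ω => inner ℝ (B t ω) (polarizedWave i.2.2 i.1 (v i)), ?_, ?_, ?_, ?_, ?_⟩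
  · intro i t
    have h : Continuous fun f : L2Field n d => (inner ℝ f (polarizedWave i.2.2 i.1 (v i)) : ℝ) := by
      fun_prop
    exact h.measurable.comp_aemeasurable (hB.measurable t)
  · filter_upwards [hB.zero] with ω hω i
    rw [hω, inner_zero_left]
  · filter_upwards [hB.continuous] with ω hω i
    fun_prop
  · intro i
    refine ⟨(inner ℝ (covOp G (polarizedWave i.2.2 i.1 (v i)))
      (polarizedWave i.2.2 i.1 (v i)) : ℝ).toNNReal, ?_, fun s t hst => ?_⟩
    · exact ENNReal.ofReal_le_ofReal (inner_covOp_polarizedWave_le G _ _ (hv2 i))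
    · simp only [← inner_sub_left]
      exact hB.gaussian s t hst _
  -- The exceptional null set depends on the test field, but there are only countably many modes.
  · rw [ae_all_iff]
    intro i
    by_cases hi : i.1 = 0
    · exact Eventually.of_forall fun ω h => absurd hi h
    · filter_upwards [hz.waveInner_eq_ouProcess hB.continuous hi (hv i hi).1 (hv i hi).2] with ω hω _
      exact hω
end

noncomputable section

/-! ### Pathwise estimates in Sobolev norms -/

/-- The weighted sum of the `p`-th roots of the dyadic sums of a family of driving paths. -/
def drivingSum {n d : ℕ} (T : ℝ≥0) (γ : ℝ) (p : ℕ) (s : ℝ)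
    (b : (Fin n → ℤ) × Fin d × Bool → ℝ≥0 → ℝ) : ℝ≥0∞ :=
  waveSum s fun i => dyadicSum T γ p (b i) ^ (p : ℝ)⁻¹

theorem ofReal_sub_sq_le (x y : ℝ) : ENNReal.ofReal ((x - y) ^ 2) ≤
    2 * (ENNReal.ofReal (x ^ 2) + ENNReal.ofReal (y ^ 2)) := by
  rw [← ENNReal.ofReal_add (sq_nonneg _) (sq_nonneg _), ← ENNReal.ofReal_ofNat 2,
    ← ENNReal.ofReal_mul two_pos.le]
  refine ENNReal.ofReal_le_ofReal ?_
  nlinarith [sq_nonneg (x + y)]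

section Pathwise

variable {n d : ℕ} {b : (Fin n → ℤ) × Fin d × Bool → ℝ≥0 → ℝ} {T : ℝ≥0} {γ s₀ : ℝ} {p : ℕ}
  {lam : ℝ} {f : ℝ≥0 → L2Field n d}

theorem dyadicSum_ne_top (hp : p ≠ 0) (hR : drivingSum T γ p s₀ b ≠ ∞)
    {i : (Fin n → ℤ) × Fin d × Bool} (hi : i.1 ≠ 0) : dyadicSum T γ p (b i) ≠ ∞ := by
  have h1 := ENNReal.ne_top_of_tsum_ne_top hR i
  have h2 : ENNReal.ofReal (fracSymbol s₀ i.1) ≠ 0 := by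
    simpa using fracSymbol_pos s₀ hi
  have h3 := (ENNReal.lt_top_of_mul_ne_top_right h1 h2).ne
  intro h
  simp only at h3
  rw [h, ENNReal.top_rpow_of_pos (by positivity)] at h3
  exact h3 rfl

/-- The factor `a^{-2 γ}` from the scalar bound lowers the index of the symbol by `2 γ lam`; the
rest is `|k| ≥ 1`. -/
theorem weighted_waveInner_sq_le (hb : ∀ i, Continuous (b i)) (hb0 : ∀ i, b i 0 = 0)
    (hf : ∀ i, i.1 ≠ 0 → ∀ t, waveInner (f t) i = ouProcess (fracSymbol lam i.1) (b i) t)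
    (hγ : 0 < γ) (hγ1 : γ ≤ 1) (hT : 0 < T) (hp : p ≠ 0) (hR : drivingSum T γ p s₀ b ≠ ∞)
    {s : ℝ} (hs : s - 2 * γ * lam ≤ s₀) {t : ℝ≥0} (ht : t ≤ T)
    {i : (Fin n → ℤ) × Fin d × Bool} (hi : i.1 ≠ 0) :
    ENNReal.ofReal (fracSymbol s i.1) * ENNReal.ofReal (waveInner (f t) i ^ 2) ≤
      ENNReal.ofReal ((6 * chainConst T γ) ^ 2) *
        (ENNReal.ofReal (fracSymbol s₀ i.1) * dyadicSum T γ p (b i) ^ (p : ℝ)⁻¹) := by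
  have hN := sum_sq_pos hi
  have hN0 : 0 < ∑ j, (i.1 j : ℝ) ^ 2 := by positivity
  have hsym : fracSymbol s i.1 * fracSymbol lam i.1 ^ (-(2 * γ)) ≤ fracSymbol s₀ i.1 := by
    simp only [fracSymbol]
    rw [← Real.rpow_mul hN0.le, ← Real.rpow_add hN0]
    exact Real.rpow_le_rpow_of_exponent_le hN (by linarith)
  rw [hf i hi]
  calc _ ≤ ENNReal.ofReal (fracSymbol s i.1) *
        (ENNReal.ofReal ((6 * chainConst T γ) ^ 2 * fracSymbol lam i.1 ^ (-(2 * γ))) *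
          dyadicSum T γ p (b i) ^ (p : ℝ)⁻¹) := by
        gcongr
        exact ofReal_ouProcess_sq_le (fracSymbol_pos lam hi) (hb i) (hb0 i) hγ hγ1 hT hp
          (dyadicSum_ne_top hp hR hi) ht
    _ = ENNReal.ofReal ((6 * chainConst T γ) ^ 2) *
          (ENNReal.ofReal (fracSymbol s i.1 * fracSymbol lam i.1 ^ (-(2 * γ))) *
          dyadicSum T γ p (b i) ^ (p : ℝ)⁻¹) := by
        rw [ENNReal.ofReal_mul (sq_nonneg _), ENNReal.ofReal_mul (fracSymbol_nonneg _ _)]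
        ring
    _ ≤ _ := by gcongr

theorem hdotNorm_path_le (hb : ∀ i, Continuous (b i)) (hb0 : ∀ i, b i 0 = 0)
    (hf : ∀ i, i.1 ≠ 0 → ∀ t, waveInner (f t) i = ouProcess (fracSymbol lam i.1) (b i) t)
    (hγ : 0 < γ) (hγ1 : γ ≤ 1) (hT : 0 < T) (hp : p ≠ 0) (hR : drivingSum T γ p s₀ b ≠ ∞)
    {s : ℝ} (hs0 : s ≠ 0) (hs : s - 2 * γ * lam ≤ s₀) {t : ℝ≥0} (ht : t ≤ T) :
    hdotNorm s (f t) ≤ (ENNReal.ofReal (((2 * Real.pi) ^ n)⁻¹) *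
      (ENNReal.ofReal ((6 * chainConst T γ) ^ 2) * drivingSum T γ p s₀ b)) ^ (1 / 2 : ℝ) :=
  hdotNorm_le hs0 fun _ hi => weighted_waveInner_sq_le hb hb0 hf hγ hγ1 hT hp hR hs ht hi

/-- Every mode is continuous in time, and the bound on the modes, uniform in time and summable, is
the dominating function. -/
theorem isContinuousHdot_path (hb : ∀ i, Continuous (b i)) (hb0 : ∀ i, b i 0 = 0)
    (hf : ∀ i, i.1 ≠ 0 → ∀ t, waveInner (f t) i = ouProcess (fracSymbol lam i.1) (b i) t)
    (hγ : 0 < γ) (hγ1 : γ ≤ 1) (hT : 0 < T) (hp : p ≠ 0) (hR : drivingSum T γ p s₀ b ≠ ∞)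
    {s : ℝ} (hs0 : s ≠ 0) (hs : s - 2 * γ * lam ≤ s₀) : IsContinuousHdot T s f := by
  intro t ht
  refine ⟨(hdotNorm_path_le hb hb0 hf hγ hγ1 hT hp hR hs0 hs ht).trans_lt
    (ENNReal.rpow_lt_top_of_nonneg (by norm_num) (ENNReal.mul_ne_top ENNReal.ofReal_ne_top
      (ENNReal.mul_ne_top ENNReal.ofReal_ne_top hR))), ?_⟩
  refine tendsto_hdotNorm_zero (s₀ := s₀) hs0
    (M := 4 * ENNReal.ofReal ((6 * chainConst T γ) ^ 2))
    (ENNReal.mul_ne_top (by simp) ENNReal.ofReal_ne_top) hR (fun i hi => ?_) ?_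
  · simp only [waveInner_sub, hf i hi]
    have h := (continuous_ouProcess (a := fracSymbol lam i.1) (hb i)).tendsto t
    have h2 := (h.sub_const (ouProcess (fracSymbol lam i.1) (b i) t)).mono_left
      (nhdsWithin_le_nhds (s := Set.Iic T))
    simpa using h2
  · filter_upwards [self_mem_nhdsWithin] with r hr i hi
    have h1 := weighted_waveInner_sq_le hb hb0 hf hγ hγ1 hT hp hR hs hr hi
    have h2 := weighted_waveInner_sq_le hb hb0 hf hγ hγ1 hT hp hR hs ht hi
    have h3 : ENNReal.ofReal (waveInner (f r - f t) i ^ 2) ≤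
        2 * (ENNReal.ofReal (waveInner (f r) i ^ 2) + ENNReal.ofReal (waveInner (f t) i ^ 2)) := by
      rw [waveInner_sub]
      exact ofReal_sub_sq_le _ _
    calc _ ≤ ENNReal.ofReal (fracSymbol s i.1) * (2 * (ENNReal.ofReal (waveInner (f r) i ^ 2) +
          ENNReal.ofReal (waveInner (f t) i ^ 2))) := by gcongr
      _ = 2 * (ENNReal.ofReal (fracSymbol s i.1) * ENNReal.ofReal (waveInner (f r) i ^ 2) +
          ENNReal.ofReal (fracSymbol s i.1) * ENNReal.ofReal (waveInner (f t) i ^ 2)) := by ring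
      _ ≤ _ := (mul_le_mul' le_rfl (add_le_add h1 h2)).trans_eq (by ring)

/-- The increment bound uniform in `a` is used mode by mode: no spatial smoothing is gained, so `s ≤
s₀`, but the full time exponent `γ` is kept. -/
theorem hdotNorm_path_sub_le (hb : ∀ i, Continuous (b i)) (hb0 : ∀ i, b i 0 = 0)
    (hf : ∀ i, i.1 ≠ 0 → ∀ t, waveInner (f t) i = ouProcess (fracSymbol lam i.1) (b i) t)
    (hγ : 0 < γ) (hT : 0 < T) (hp : p ≠ 0) (hR : drivingSum T γ p s₀ b ≠ ∞)
    {s : ℝ} (hs0 : s ≠ 0) (hs : s ≤ s₀) {r t : ℝ≥0} (hr : r ≤ T) (ht : t ≤ T) :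
    hdotNorm s (f t - f r) ≤ edist t r ^ γ * (ENNReal.ofReal (((2 * Real.pi) ^ n)⁻¹) *
      (ENNReal.ofReal ((2 * chainConst T γ) ^ 2) * drivingSum T γ p s₀ b)) ^ (1 / 2 : ℝ) := by
  refine (hdotNorm_le (s₀ := s₀) (M := ENNReal.ofReal ((2 * chainConst T γ * dist t r ^ γ) ^ 2))
    (Y := fun i => dyadicSum T γ p (b i) ^ (p : ℝ)⁻¹) hs0 fun i hi => ?_).trans_eq ?_
  · rw [waveInner_sub, hf i hi, hf i hi, mul_left_comm]
    gcongr
    · exact fracSymbol_le_of_le hs hi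
    · exact ofReal_ouProcess_sub_sq_le (fracSymbol_pos lam hi) (hb i) (hb0 i) hγ hT hp
        (dyadicSum_ne_top hp hR hi) hr ht
  · have h1 : ENNReal.ofReal ((2 * chainConst T γ * dist t r ^ γ) ^ 2) =
        ENNReal.ofReal ((2 * chainConst T γ) ^ 2) * (edist t r ^ γ) ^ 2 := by
      rw [mul_pow, ENNReal.ofReal_mul (sq_nonneg _), edist_dist,
        ENNReal.ofReal_rpow_of_nonneg dist_nonneg hγ.le, ← ENNReal.ofReal_pow (by positivity)]
    have h2 : edist t r ^ γ = ((edist t r ^ γ) ^ 2) ^ (1 / 2 : ℝ) := by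
      rw [← ENNReal.rpow_natCast, ← ENNReal.rpow_mul]; norm_num
    rw [h1, drivingSum]
    conv_rhs => rw [h2]
    rw [← ENNReal.mul_rpow_of_nonneg _ _ (by norm_num)]
    congr 1
    ring

theorem holderHdotNorm_path_le (hb : ∀ i, Continuous (b i)) (hb0 : ∀ i, b i 0 = 0)
    (hf : ∀ i, i.1 ≠ 0 → ∀ t, waveInner (f t) i = ouProcess (fracSymbol lam i.1) (b i) t)
    (hγ : 0 < γ) (hT : 0 < T) (hp : p ≠ 0) (hR : drivingSum T γ p s₀ b ≠ ∞)
    {s : ℝ} (hs0 : s ≠ 0) (hs : s ≤ s₀) :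
    holderHdotNorm T γ s f ≤ supHdotNorm T s f + (ENNReal.ofReal (((2 * Real.pi) ^ n)⁻¹) *
      (ENNReal.ofReal ((2 * chainConst T γ) ^ 2) * drivingSum T γ p s₀ b)) ^ (1 / 2 : ℝ) := by
  refine add_le_add le_rfl (iSup₂_le fun r hr => iSup₂_le fun t ht => iSup_le fun _ => ?_)
  exact ENNReal.div_le_of_le_mul' (hdotNorm_path_sub_le hb hb0 hf hγ hT hp hR hs0 hs hr ht)

theorem supHdotNorm_mono {s s' : ℝ} (hs : s ≠ 0) (h : s ≤ s') :
    supHdotNorm T s f ≤ supHdotNorm T s' f :=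
  iSup₂_mono fun _ _ => hdotNorm_mono hs h _

theorem hdotNorm_smul (s : ℝ) {c : ℝ} (hc : 0 ≤ c) (g : L2Field n d) :
    hdotNorm s (c • g) = ENNReal.ofReal c * hdotNorm s g := by
  have h1 : ∀ i, ENNReal.ofReal (waveInner (c • g) i ^ 2) =
      ENNReal.ofReal c ^ 2 * ENNReal.ofReal (waveInner g i ^ 2) := fun i => by
    rw [waveInner, real_inner_smul_left, mul_pow, ENNReal.ofReal_mul (sq_nonneg _),
      ENNReal.ofReal_pow hc]
    rfl
  have h2 : ENNReal.ofReal c = (ENNReal.ofReal c ^ 2) ^ (1 / 2 : ℝ) := by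
    rw [← ENNReal.rpow_natCast, ← ENNReal.rpow_mul]; norm_num
  rw [hdotNorm_eq_waveSum, hdotNorm_eq_waveSum]
  conv_rhs => rw [h2]
  rw [← ENNReal.mul_rpow_of_nonneg _ _ (by norm_num), mul_left_comm]
  congr 2
  simp only [waveSum, h1, ← ENNReal.tsum_mul_left]
  exact tsum_congr fun i => mul_left_comm _ _ _

/-- The pairs of different times in `[0, T]`. -/
abbrev TimePair (T : ℝ≥0) : Type := {x : ℝ≥0 × ℝ≥0 // x.1 ≤ T ∧ x.2 ≤ T ∧ x.1 ≠ x.2}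

/-- With the quotient inside the norm, the supremum runs over norms of fields whose coefficients are
continuous off the diagonal when those of the path are, so the lower semicontinuity argument
applies. -/
theorem holderHdotNorm_eq_iSup (hγ : 0 ≤ γ) (s : ℝ) :
    holderHdotNorm T γ s f = supHdotNorm T s f +
      ⨆ x : TimePair T, hdotNorm s ((dist x.1.2 x.1.1 ^ γ)⁻¹ • (f x.1.2 - f x.1.1)) := by
  have h : ∀ r t : ℝ≥0, r ≠ t → hdotNorm s (f t - f r) / edist t r ^ γ =
      hdotNorm s ((dist t r ^ γ)⁻¹ • (f t - f r)) := fun r t hrt => by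
    have hd : 0 < dist t r := dist_pos.2 hrt.symm
    rw [hdotNorm_smul s (by positivity), ENNReal.ofReal_inv_of_pos (by positivity), edist_dist,
      ENNReal.ofReal_rpow_of_nonneg dist_nonneg hγ, div_eq_mul_inv, mul_comm]
  rw [holderHdotNorm]
  congr 1
  refine le_antisymm (iSup₂_le fun r hr => iSup₂_le fun t ht => iSup_le fun hrt => ?_)
    (iSup_le fun x => ?_)
  · rw [h r t hrt]
    exact le_iSup (fun x : TimePair T =>
      hdotNorm s ((dist x.1.2 x.1.1 ^ γ)⁻¹ • (f x.1.2 - f x.1.1))) ⟨(r, t), hr, ht, hrt⟩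
  · obtain ⟨⟨r, t⟩, hr, ht, hrt⟩ := x
    rw [← h r t hrt]
    exact le_iSup₂_of_le r hr (le_iSup₂_of_le t ht (le_iSup_of_le hrt le_rfl))

end Pathwise

/-! ### Measurability of the norms and their moments -/

section Random

variable {Ω : Type*} [MeasurableSpace Ω] {P : Measure Ω} {n d : ℕ} {lam : ℝ}
  {z : ℝ≥0 → Ω → L2Field n d} {q : (Fin n → ℤ) × Fin d × Bool → ℝ}
  {β : (Fin n → ℤ) × Fin d × Bool → ℝ≥0 → Ω → ℝ}

theorem IsDriver.aemeasurable_waveInner (h : IsDriver P lam z q β)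
    {i : (Fin n → ℤ) × Fin d × Bool} (hi : i.1 ≠ 0) (t : ℝ≥0) :
    AEMeasurable (fun ω => waveInner (z t ω) i) P := by
  refine (aemeasurable_ouProcess (h.aemeasurable i) (h.continuous.mono fun ω hω => hω i)
    (fracSymbol lam i.1) t).congr ?_
  filter_upwards [h.waveInner_eq] with ω hω
  exact (hω i hi t).symm

theorem IsDriver.continuous_waveInner (h : IsDriver P lam z q β) :
    ∀ᵐ ω ∂P, ∀ i, i.1 ≠ 0 → Continuous fun t => waveInner (z t ω) i := by
  filter_upwards [h.continuous, h.waveInner_eq] with ω h1 h2 i hi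
  simp only [h2 i hi]
  exact continuous_ouProcess (h1 i)

theorem aemeasurable_hdotNorm {s : ℝ} (hs : s ≠ 0) {g : Ω → L2Field n d}
    (hg : ∀ i, i.1 ≠ 0 → AEMeasurable (fun ω => waveInner (g ω) i) P) :
    AEMeasurable (fun ω => hdotNorm s (g ω)) P := by
  simp only [hdotNorm_eq_waveSum]
  refine (AEMeasurable.const_mul (AEMeasurable.tsum fun i => ?_) _).pow_const _
  by_cases hi : i.1 = 0
  · simp [hi, fracSymbol_zero hs]
  · exact (((hg i hi).pow_const 2).ennreal_ofReal).const_mul _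

theorem IsDriver.aemeasurable_supHdotNorm (h : IsDriver P lam z q β) (T : ℝ≥0) {s : ℝ}
    (hs : s ≠ 0) : AEMeasurable (fun ω => supHdotNorm T s fun t => z t ω) P := by
  simp only [supHdotNorm, ← iSup_subtype'']
  refine aemeasurable_iSup_of_lowerSemicontinuous
    (fun t => aemeasurable_hdotNorm hs fun i hi => h.aemeasurable_waveInner hi t) ?_
  filter_upwards [h.continuous_waveInner] with ω hω
  exact lowerSemicontinuous_hdotNorm hs fun i hi => (hω i hi).comp continuous_subtype_val

theorem IsDriver.aemeasurable_holderHdotNorm (h : IsDriver P lam z q β) (T : ℝ≥0) {γ s : ℝ}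
    (hγ : 0 ≤ γ) (hs : s ≠ 0) : AEMeasurable (fun ω => holderHdotNorm T γ s fun t => z t ω) P := by
  simp only [holderHdotNorm_eq_iSup hγ]
  refine (h.aemeasurable_supHdotNorm T hs).add (aemeasurable_iSup_of_lowerSemicontinuous
    (fun x => aemeasurable_hdotNorm hs fun i hi => ?_) ?_)
  · simp only [waveInner, real_inner_smul_left, inner_sub_left]
    exact ((h.aemeasurable_waveInner hi _).sub (h.aemeasurable_waveInner hi _)).const_mul _
  · filter_upwards [h.continuous_waveInner] with ω hω
    refine lowerSemicontinuous_hdotNorm hs fun i hi => ?_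
    have hi' := hω i hi
    simp only [waveInner] at hi'
    simp only [waveInner, real_inner_smul_left, inner_sub_left]
    refine Continuous.mul (Continuous.inv₀ ((by fun_prop : Continuous fun x : TimePair T =>
      dist x.1.2 x.1.1).rpow_const fun _ => Or.inr hγ) fun x => ?_) ?_
    · exact (Real.rpow_pos_of_pos (dist_pos.2 x.2.2.2.symm) γ).ne'
    · exact (hi'.comp (by fun_prop)).sub (hi'.comp (by fun_prop))

theorem IsDriver.aemeasurable_drivingSum (h : IsDriver P lam z q β) (T : ℝ≥0) (γ : ℝ) (p : ℕ)
    (s : ℝ) : AEMeasurable (fun ω => drivingSum T γ p s fun i t => β i t ω) P :=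
  AEMeasurable.tsum fun i =>
    ((aemeasurable_dyadicSum (h.aemeasurable i) T γ p).pow_const _).const_mul _

/-- The `p`-th root of a dyadic sum has `L^p` norm at most a constant times the variance. Being
linear in the variance, these norms add up by Minkowski to the trace-type sum. -/
theorem IsDriver.lintegral_drivingSum_lt_top (h : IsDriver P lam z q β) (T : ℝ≥0) {γ : ℝ} {p : ℕ}
    (hp : p ≠ 0) (hγ : 1 < p * (1 - 2 * γ)) {s : ℝ}
    (hq : waveSum s (fun i => ENNReal.ofReal (q i)) < ∞) :
    ∫⁻ ω, (drivingSum T γ p s fun i t => β i t ω) ^ p ∂P < ∞ := by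
  have hp1 : (1 : ℝ) ≤ p := by exact_mod_cast Nat.one_le_iff_ne_zero.2 hp
  have hp0 : (0 : ℝ) < p := by linarith
  have hpne : (p : ℝ) ≠ 0 := hp0.ne'
  have hM := lintegral_tsum_rpow_le (P := P) (f := fun (i : (Fin n → ℤ) × Fin d × Bool) ω =>
    ENNReal.ofReal (fracSymbol s i.1) * dyadicSum T γ p (fun t => β i t ω) ^ (p : ℝ)⁻¹)
    (fun i => ((aemeasurable_dyadicSum (h.aemeasurable i) T γ p).pow_const _).const_mul _) hp1
  have hterm : ∀ i : (Fin n → ℤ) × Fin d × Bool, (∫⁻ ω, (ENNReal.ofReal (fracSymbol s i.1) *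
      dyadicSum T γ p (fun t => β i t ω) ^ (p : ℝ)⁻¹) ^ (p : ℝ) ∂P) ^ (1 / (p : ℝ)) ≤
      dyadicConst T γ p ^ (1 / (p : ℝ)) *
        (ENNReal.ofReal (fracSymbol s i.1) * ENNReal.ofReal (q i)) := fun i => by
    obtain ⟨v, hv, hg⟩ := h.gaussian i
    simp only [ENNReal.mul_rpow_of_nonneg _ _ hp0.le, ENNReal.rpow_inv_rpow hpne]
    rw [lintegral_const_mul'' _ (aemeasurable_dyadicSum (h.aemeasurable i) T γ p)]
    calc _ ≤ (ENNReal.ofReal (fracSymbol s i.1) ^ (p : ℝ) *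
          (dyadicConst T γ p * (v : ℝ≥0∞) ^ p)) ^ (1 / (p : ℝ)) := by
          gcongr
          exact lintegral_dyadicSum_le (h.aemeasurable i) hg T γ p
      _ = dyadicConst T γ p ^ (1 / (p : ℝ)) * (ENNReal.ofReal (fracSymbol s i.1) * v) := by
          rw [ENNReal.mul_rpow_of_nonneg _ _ (by positivity),
            ENNReal.mul_rpow_of_nonneg _ _ (by positivity), ← ENNReal.rpow_natCast, one_div,
            ENNReal.rpow_rpow_inv hpne, ENNReal.rpow_rpow_inv hpne]
          ring
      _ ≤ _ := by gcongr
  have hfin : (∫⁻ ω, (drivingSum T γ p s fun i t => β i t ω) ^ (p : ℝ) ∂P) ^ (1 / (p : ℝ)) < ∞ := by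
    refine (hM.trans (ENNReal.tsum_le_tsum hterm)).trans_lt ?_
    rw [ENNReal.tsum_mul_left]
    exact ENNReal.mul_lt_top (ENNReal.rpow_lt_top_of_nonneg (by positivity)
      (dyadicConst_lt_top T hp hγ).ne) hq
  rw [ENNReal.rpow_lt_top_iff_of_pos (by positivity)] at hfin
  simpa only [ENNReal.rpow_natCast] using hfin

/-- `F ^ l ≤ 1 + F ^ (2 p)`, and the constant is integrable on a probability space. -/
theorem lintegral_pow_lt_top_of_le_rpow [IsProbabilityMeasure P] {F R : Ω → ℝ≥0∞} {c : ℝ≥0∞}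
    {l p : ℕ} (hc : c ≠ ∞) (hlp : l ≤ 2 * p) (hFR : ∀ᵐ ω ∂P, F ω ≤ (c * R ω) ^ (1 / 2 : ℝ))
    (hR : ∫⁻ ω, R ω ^ p ∂P < ∞) : ∫⁻ ω, F ω ^ l ∂P < ∞ := by
  have h1 : ∫⁻ ω, F ω ^ l ∂P ≤ ∫⁻ ω, (1 + c ^ p * R ω ^ p) ∂P := by
    refine lintegral_mono_ae ?_
    filter_upwards [hFR] with ω hω
    have h2 : F ω ^ (2 * p) ≤ c ^ p * R ω ^ p := by
      rw [← mul_pow, pow_mul]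
      refine pow_le_pow_left₀ zero_le ?_ p
      refine (pow_le_pow_left₀ zero_le hω 2).trans_eq ?_
      rw [← ENNReal.rpow_natCast, ← ENNReal.rpow_mul]; norm_num
    rcases le_total (F ω) 1 with h | h
    · exact (pow_le_one₀ zero_le h).trans le_self_add
    · exact (pow_le_pow_right₀ h hlp).trans (h2.trans le_add_self)
  refine h1.trans_lt ?_
  rw [lintegral_add_left measurable_const, lintegral_const, measure_univ, mul_one,
    lintegral_const_mul' _ _ (ENNReal.pow_ne_top hc)]
  exact ENNReal.add_lt_top.2 ⟨by simp, ENNReal.mul_lt_top (ENNReal.pow_lt_top hc.lt_top) hR⟩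

theorem exists_moment_order {γ : ℝ} (hγ : γ < 1 / 2) (l : ℕ) :
    ∃ p : ℕ, p ≠ 0 ∧ 1 < p * (1 - 2 * γ) ∧ l ≤ 2 * p := by
  have h0 : 0 < 1 - 2 * γ := by linarith
  obtain ⟨m, hm⟩ := exists_nat_gt (1 / (1 - 2 * γ))
  rw [div_lt_iff₀ h0] at hm
  refine ⟨m + l + 1, by omega, ?_, by omega⟩
  push_cast
  nlinarith [mul_nonneg (Nat.cast_nonneg (α := ℝ) l) h0.le]

theorem IsDriver.ae_drivingSum_ne_top (h : IsDriver P lam z q β) (T : ℝ≥0) {γ : ℝ} {p : ℕ}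
    (hp : p ≠ 0) (hγ : 1 < p * (1 - 2 * γ)) {s : ℝ}
    (hq : waveSum s (fun i => ENNReal.ofReal (q i)) < ∞) :
    ∀ᵐ ω ∂P, (drivingSum T γ p s fun i t => β i t ω) ≠ ∞ := by
  filter_upwards [ae_lt_top' ((h.aemeasurable_drivingSum T γ p s).pow_const p)
    (h.lintegral_drivingSum_lt_top T hp hγ hq).ne] with ω hω
  rw [ENNReal.pow_lt_top_iff] at hω
  exact (hω.resolve_right hp).ne

theorem IsDriver.hasRegularityMoments [IsProbabilityMeasure P] (h : IsDriver P lam z q β)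
    (hlam : 0 < lam) {σ s₀ : ℝ} (hσ : 0 < σ) (hs₁ : (n : ℝ) / 2 + 2 * σ ≤ s₀)
    (hs₂ : ((n : ℝ) + 2) / 2 - lam + 2 * σ ≤ s₀)
    (hq : waveSum s₀ (fun i => ENNReal.ofReal (q i)) < ∞) : HasRegularityMoments P σ z := by
  intro δ hδ0 hδ T hT l
  have hn : (0 : ℝ) ≤ n := Nat.cast_nonneg n
  have hsup0 : (2 + (n : ℝ) + σ) / 2 ≠ 0 := by positivity
  have hhol0 : ((n : ℝ) + σ) / 2 ≠ 0 := by positivity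
  obtain ⟨γ, hγ0, hγ, hγs⟩ : ∃ γ : ℝ, 0 < γ ∧ γ < 1 / 2 ∧
      (2 + (n : ℝ) + σ) / 2 - 2 * γ * lam ≤ s₀ := by
    -- The second entry gives `2 γ lam ≥ lam - σ`, so the required index is at most `(n+2)/2 - lam +
    -- 3σ/2`, below `s₀`. The entry `1/4` only keeps `γ` positive when `σ` is large compared with
    -- `lam`.
    refine ⟨max (1 / 4) (1 / 2 - σ / (2 * lam)), by positivity,
      max_lt (by norm_num) (by linarith [show 0 < σ / (2 * lam) by positivity]), ?_⟩
    have h1 := le_max_right (1 / 4 : ℝ) (1 / 2 - σ / (2 * lam))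
    have h2 : σ / (2 * lam) * (2 * lam) = σ := by field_simp
    nlinarith
  obtain ⟨p, hp, hpγ, hlp⟩ := exists_moment_order hγ l
  -- The Hölder norm needs the exponent `1/2 - δ` itself, hence its own moment order.
  obtain ⟨p', hp', hpδ, hlp'⟩ := exists_moment_order (γ := 1 / 2 - δ) (by linarith) l
  have hR := h.ae_drivingSum_ne_top T hp hpγ hq
  have hR' := h.ae_drivingSum_ne_top T hp' hpδ hq
  have hmsup := h.aemeasurable_supHdotNorm T hsup0
  refine ⟨?_, hmsup, h.aemeasurable_holderHdotNorm T (by linarith) hhol0, ?_⟩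
  · filter_upwards [h.continuous, h.zero, h.waveInner_eq, hR] with ω h1 h2 h3 h4
    exact isContinuousHdot_path h1 h2 h3 hγ0 (by linarith) hT hp h4 hsup0 hγs
  have hsup : ∫⁻ ω, (supHdotNorm T ((2 + n + σ) / 2) fun t => z t ω) ^ l ∂P < ∞ := by
    refine lintegral_pow_lt_top_of_le_rpow (c := ENNReal.ofReal (((2 * Real.pi) ^ n)⁻¹) *
      ENNReal.ofReal ((6 * chainConst T γ) ^ 2))
      (ENNReal.mul_ne_top ENNReal.ofReal_ne_top ENNReal.ofReal_ne_top) hlp ?_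
      (h.lintegral_drivingSum_lt_top T hp hpγ hq)
    filter_upwards [h.continuous, h.zero, h.waveInner_eq, hR] with ω h1 h2 h3 h4
    rw [mul_assoc]
    exact iSup₂_le fun t ht =>
      hdotNorm_path_le h1 h2 h3 hγ0 (by linarith) hT hp h4 hsup0 hγs ht
  set K : Ω → ℝ≥0∞ := fun ω => (ENNReal.ofReal (((2 * Real.pi) ^ n)⁻¹) *
      ENNReal.ofReal ((2 * chainConst T (1 / 2 - δ)) ^ 2) *
        drivingSum T (1 / 2 - δ) p' s₀ fun i t => β i t ω) ^ (1 / 2 : ℝ) with hK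
  have hKl : ∫⁻ ω, K ω ^ l ∂P < ∞ :=
    lintegral_pow_lt_top_of_le_rpow
      (ENNReal.mul_ne_top ENNReal.ofReal_ne_top ENNReal.ofReal_ne_top) hlp'
      (Eventually.of_forall fun ω => le_rfl) (h.lintegral_drivingSum_lt_top T hp' hpδ hq)
  have hhol : ∫⁻ ω, (holderHdotNorm T (1 / 2 - δ) ((n + σ) / 2) fun t => z t ω) ^ l ∂P < ∞ := by
    have h5 : ∫⁻ ω, (holderHdotNorm T (1 / 2 - δ) ((n + σ) / 2) fun t => z t ω) ^ l ∂P ≤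
        ∫⁻ ω, 2 ^ l * ((supHdotNorm T ((2 + n + σ) / 2) fun t => z t ω) ^ l + K ω ^ l) ∂P := by
      refine lintegral_mono_ae ?_
      filter_upwards [h.continuous, h.zero, h.waveInner_eq, hR'] with ω h1 h2 h3 h4
      have h6 := holderHdotNorm_path_le h1 h2 h3 (by linarith : 0 < 1 / 2 - δ) hT hp' h4 hhol0
        (by linarith)
      rw [← mul_assoc] at h6
      -- The supremum part of the Hölder norm is absorbed by the stronger norm already estimated.
      have h7 := h6.trans (add_le_add (supHdotNorm_mono (T := T) (f := fun t => z t ω) hhol0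
        (by linarith : ((n : ℝ) + σ) / 2 ≤ (2 + n + σ) / 2)) le_rfl)
      refine (pow_le_pow_left₀ zero_le h7 l).trans ?_
      rw [mul_add]
      set A := supHdotNorm T ((2 + n + σ) / 2) fun t => z t ω
      change (A + K ω) ^ l ≤ _
      rcases le_total A (K ω) with hAK | hAK
      · calc (A + K ω) ^ l ≤ (2 * K ω) ^ l := by rw [two_mul]; gcongr
          _ = 2 ^ l * K ω ^ l := mul_pow _ _ _
          _ ≤ _ := le_add_self
      · calc (A + K ω) ^ l ≤ (2 * A) ^ l := by rw [two_mul]; gcongr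
          _ = 2 ^ l * A ^ l := mul_pow _ _ _
          _ ≤ _ := le_self_add
    refine h5.trans_lt ?_
    rw [lintegral_const_mul' _ _ (by simp), lintegral_add_left' (hmsup.pow_const l)]
    exact ENNReal.mul_lt_top (by simp) (ENNReal.add_lt_top.2 ⟨hsup, hKl⟩)
  rw [lintegral_add_left' (hmsup.pow_const l)]
  exact ENNReal.add_lt_top.2 ⟨hsup, hhol⟩

theorem IsWeakSolution.hasRegularityMoments [IsProbabilityMeasure P] {U : Type*}
    [NormedAddCommGroup U] [InnerProductSpace ℝ U] [CompleteSpace U] {V : L2Field n d → Prop}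
    (hV : IsWaveTested V) (hlam : 0 < lam) {σ : ℝ} (hσ : 0 < σ) {G : U →L[ℝ] L2Field n d}
    {B : ℝ≥0 → Ω → L2Field n d}
    (hG : traceFracLaplacian (max ((n : ℝ) / 2 + 2 * σ) (((n : ℝ) + 2) / 2 - lam + 2 * σ))
      (covOp G) < ∞)
    (hB : IsWienerProcess P (covOp G) B) (hz : IsWeakSolution P V lam B z) :
    HasRegularityMoments P σ z := by
  obtain ⟨β, hβ⟩ := hz.exists_isDriver hV hB
  exact hβ.hasRegularityMoments hlam hσ (le_max_left _ _) (le_max_right _ _)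
    (waveSum_waveVariance_lt_top hG)

end Random

end

/-! ### Assembly of the three assertions. -/

theorem proposition4p4 {Ω : Type*} [MeasurableSpace Ω] (P : Measure Ω) [IsProbabilityMeasure P]
    {U : Type*} [NormedAddCommGroup U] [InnerProductSpace ℝ U] [CompleteSpace U]
    {U₁ : Type*} [NormedAddCommGroup U₁] [InnerProductSpace ℝ U₁] [CompleteSpace U₁]
    {U₂ : Type*} [NormedAddCommGroup U₂] [InnerProductSpace ℝ U₂] [CompleteSpace U₂]
    (n : ℕ) (hn : n = 2 ∨ n = 3) (σ : ℝ) (hσ : 0 < σ) :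
    -- the equation with pressure
    (∀ (lam : ℝ) (G : U →L[ℝ] L2Field n n) (B z : ℝ≥0 → Ω → L2Field n n),
      0 < lam → lam < 1 / 2 + (n : ℝ) / 4 → (∀ u, IsMeanZero (G u)) →
      traceFracLaplacian (max ((n : ℝ) / 2 + 2 * σ) (((n : ℝ) + 2) / 2 - lam + 2 * σ))
        (covOp G) < ∞ →
      IsWienerProcess P (covOp G) B → IsStokesSolution P lam B z →
      HasRegularityMoments P σ z) ∧
    -- the equation without pressure
    (∀ (d : ℕ) (lam : ℝ) (G : U →L[ℝ] L2Field n d) (B z : ℝ≥0 → Ω → L2Field n d),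
      0 < lam → lam < 1 / 2 + (n : ℝ) / 4 → (∀ u, IsMeanZero (G u)) →
      traceFracLaplacian (max ((n : ℝ) / 2 + 2 * σ) (((n : ℝ) + 2) / 2 - lam + 2 * σ))
        (covOp G) < ∞ →
      IsWienerProcess P (covOp G) B → IsHeatSolution P lam B z →
      HasRegularityMoments P σ z) ∧
    -- the linear parts of the velocity and of the temperature equation
    (∀ (m : ℝ) (G₁ : U₁ →L[ℝ] L2Field n n) (G₂ : U₂ →L[ℝ] L2Field n 1)
      (B₁ z₁ : ℝ≥0 → Ω → L2Field n n) (B₂ z₂ : ℝ≥0 → Ω → L2Field n 1),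
      (n = 2 → 0 < m ∧ m < 1) → (n = 3 → 13 / 20 < m ∧ m < 5 / 4) →
      (∀ u, IsSolenoidal (G₁ u)) → (∀ u, IsMeanZero (G₂ u)) →
      traceFracLaplacian (max ((n : ℝ) / 2 + 2 * σ) (((n : ℝ) + 2) / 2 - m + 2 * σ))
        (covOp G₁) < ∞ →
      traceFracLaplacian ((n : ℝ) / 2 + 2 * σ) (covOp G₂) < ∞ →
      IsWienerProcess P (covOp G₁) B₁ → IsWienerProcess P (covOp G₂) B₂ →
      IsStokesSolution P m B₁ z₁ → IsHeatSolution P 1 B₂ z₂ →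
      HasRegularityMoments P σ z₁ ∧ HasRegularityMoments P σ z₂) := by
  refine ⟨fun lam G B z hlam _ _ hG hB hz => ?_, fun d lam G B z hlam _ _ hG hB hz => ?_,
    fun m G₁ G₂ B₁ z₁ B₂ z₂ hm2 hm3 _ _ hG₁ hG₂ hB₁ hB₂ hz₁ hz₂ => ⟨?_, ?_⟩⟩
  · exact IsWeakSolution.hasRegularityMoments isWaveTested_isSolenoidal hlam hσ hG hB hz
  · exact IsWeakSolution.hasRegularityMoments isWaveTested_isMeanZero hlam hσ hG hB hz
  · have hm : 0 < m := by
      rcases hn with h | h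
      · exact (hm2 h).1
      · linarith [(hm3 h).1]
    exact IsWeakSolution.hasRegularityMoments isWaveTested_isSolenoidal hm hσ hG₁ hB₁ hz₁
  · refine IsWeakSolution.hasRegularityMoments isWaveTested_isMeanZero one_pos hσ ?_ hB₂ hz₂
    -- For exponent `1` the two entries of the maximum coincide, so the trace condition on `G₂` is
    -- the general one.
    rwa [max_eq_left (by linarith)]
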